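/- Let $\mathcal C$ be a symmetric monoidal abelian category with unit object $I$ and symmetry $\psi$, and let $(H,m,\eta,\Delta,\varepsilon,S)$ be a Hopf algebra in $\mathcal C$ which is commutative, i.e. $m\psi=m$. Write $H^n=H^{\otimes n}$, $H^0=I$. Then $(\varepsilon,\eta)$ is a braided modular pair in involution for $H$: $\varepsilon$ is an algebra map $H\to I$, $\eta$ is a coalgebra map $I\to H$, $\varepsilon\eta=\mathrm{id}_I$, and $m(m\otimes \mathrm{id})(S\eta\otimes\widetilde S^2\otimes\eta)=\mathrm{id}_H$, where $\widetilde S=(\varepsilon\otimes S)\Delta$. Moreover the objects $C^n=H^n$ with the cofaces $\delta_i:H^{n}\to H^{n+1}$, $$\delta_0=(\eta,1,\dots,1),\qquad \delta_i=(1,\dots,\underset{i\text{-th}}{\Delta},\dots,1)\ (1\le i\le n),\qquad \delta_{n+1}=(1,\dots,1,\eta),$$ the codegeneracies $\sigma_i=(1,\dots,\underset{(i+1)\text{-th}}{\varepsilon},\dots,1):H^{n+1}\to H^n$ $(0\le i\le n)$ and the cyclic operators $\tau_0=\mathrm{id}_I$, $\tau_n=m_{H^n}(\Delta^{n-1}\widetilde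 S\otimes 1_{H^{n-1}}\otimes\eta):H^n\to H^n$ $(n\ge1)$, where $m_{H^n}$ is the multiplication of the tensor power algebra $H^n$, form a cocyclic object in $\mathcal C$, and for every $n\ge 0$ there is an isomorphism in $\mathcal C$ $$HC^n_{(\varepsilon,\eta)}(H)\;\cong\;\bigoplus_{\substack{0\le i\le n\\ i\equiv n\ (\mathrm{mod}\ 2)}} HH^i(H,I).$$ Here $HC^n_{(\varepsilon,\eta)}(H)$ is the $n$-th cyclic cohomology of this cocyclic object, that is, the $n$-th cohomology of the total complex of the first-quadrant cyclic bicomplex whose entry in column $p$ and row $q$ is $H^q$, whose even columns have differential $b=\sum_{i=0}^{q+1}(-1)^i\delta_i$, whose odd columns have differential $-b'=-\sum_{i=0}^{q}(-1)^i\delta_i$, and whose rows have the differentials $1-t$ (from even to odd columns) and $1+t+\dots+t^q$ (from odd to even columns), with $t=(-1)^q\tau_q$. And $HH^i(H,I)$ is the $i$-th Hochschild cohomology of the coalgebra $H$ with coefficients in $I$, regarded as an $H$-bicomodule through $\eta$ on both sides, that is, the $i$-th cohomology of the complex $(H^n,\,b)_{n\ge0}$ with $b=\eta\otimes 1_{H^n}+\sum_{i=1}^{n}(-1)^i(1,\dots,\underset{i\text{-th}}{\Delta},\dots,1)+(-1)^{n+1}\,1_{H^n}\otimes\eta$.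 -/

import Mathlib

open CategoryTheory MonoidalCategory Limits
open scoped MonObj ComonObj HopfObj

universe v u

noncomputable section

namespace HopfCyclic

/-! ### Cocyclic objects -/

/-- The raw data of a cocyclic object: objects `X n`, cofaces `δ n i : X n ⟶ X (n + 1)` (relevant for
`i ≤ n + 1`), codegeneracies `σ n i : X (n + 1) ⟶ X n` (relevant for `i ≤ n`) and cyclic operators
`τ n : X n ⟶ X n`. The values outside the indicated ranges play no role. -/
structure CocyclicData (C : Type u) [Category.{v} C] where
  X : ℕ → C
  δ : ∀ n : ℕ, ℕ → (X n ⟶ X (n + 1))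
  σ : ∀ n : ℕ, ℕ → (X (n + 1) ⟶ X n)
  τ : ∀ n : ℕ, X n ⟶ X n

/-- The `k`-th power of an endomorphism. -/
def iter {C : Type u} [Category.{v} C] {A : C} (f : A ⟶ A) : ℕ → (A ⟶ A)
  | 0 => 𝟙 A
  | k + 1 => iter f k ≫ f

lemma iter_comm {C : Type u} [Category.{v} C] {A : C} (f : A ⟶ A) (k : ℕ) : f ≫ iter f k = iter f k ≫ f := by
  induction k with
  | zero => simp [iter]
  | succ k ih => simp only [iter]; rw [← Category.assoc, ih]

lemma iter_add {C : Type u} [Category.{v} C] {A : C} (f : A ⟶ A) (k l : ℕ) : iter f (k + l) = iter f k ≫ iter f l := by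
  induction l with
  | zero => simp [iter]
  | succ l ih => rw [← add_assoc]; simp only [iter]; rw [ih, Category.assoc]

/-- The axioms of a cocyclic object (Connes). Composition is written in diagrammatic order. -/
structure CocyclicData.IsCocyclic {C : Type u} [Category.{v} C] (D : CocyclicData C) : Prop where
  δ_δ : ∀ n i j, i ≤ j → j ≤ n + 1 → D.δ n i ≫ D.δ (n + 1) (j + 1) = D.δ n j ≫ D.δ (n + 1) i
  σ_σ : ∀ n i j, i ≤ j → j ≤ n → D.σ (n + 1) i ≫ D.σ n j = D.σ (n + 1) (j + 1) ≫ D.σ n i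
  δ_σ_lt : ∀ n i j, i ≤ j → j ≤ n → D.δ (n + 1) i ≫ D.σ (n + 1) (j + 1) = D.σ n j ≫ D.δ n i
  δ_σ_self : ∀ n i, i ≤ n → D.δ n i ≫ D.σ n i = 𝟙 (D.X n)
  δ_σ_succ : ∀ n i, i ≤ n → D.δ n (i + 1) ≫ D.σ n i = 𝟙 (D.X n)
  δ_σ_gt : ∀ n i j, j < i → i ≤ n + 1 →
    D.δ (n + 1) (i + 1) ≫ D.σ (n + 1) j = D.σ n j ≫ D.δ n i
  δ_zero_τ : ∀ n, D.δ n 0 ≫ D.τ (n + 1) = D.δ n (n + 1)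
  δ_succ_τ : ∀ n i, i ≤ n → D.δ n (i + 1) ≫ D.τ (n + 1) = D.τ n ≫ D.δ n i
  σ_zero_τ : ∀ n, D.σ n 0 ≫ D.τ n = D.τ (n + 1) ≫ D.τ (n + 1) ≫ D.σ n n
  σ_succ_τ : ∀ n i, i + 1 ≤ n → D.σ n (i + 1) ≫ D.τ n = D.τ (n + 1) ≫ D.σ n i
  τ_pow : ∀ n, iter (D.τ n) (n + 1) = 𝟙 (D.X n)

/-! ### Alternating sums of cofaces -/

section AltSum

variable {C : Type u} [Category.{v} C] [Preadditive C]

/-- The alternating sum `∑_{i < k} (-1)^i f i`. -/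
def altSum {A B : C} (k : ℕ) (f : ℕ → (A ⟶ B)) : A ⟶ B :=
  ∑ i ∈ Finset.range k, (-1 : ℤ) ^ i • f i

lemma altSum_comp_altSum {A B E : C} (k : ℕ) (f : ℕ → (A ⟶ B)) (g : ℕ → (B ⟶ E))
    (hfg : ∀ i j, i ≤ j → j < k → f i ≫ g (j + 1) = f j ≫ g i) :
    altSum k f ≫ altSum (k + 1) g = 0 := by
  simp only [altSum, Preadditive.sum_comp, Preadditive.comp_sum, Preadditive.zsmul_comp,
    Preadditive.comp_zsmul, Finset.smul_sum, smul_smul]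
  rw [Finset.sum_comm, ← Finset.sum_product']
  refine Finset.sum_involution
    (fun p _ => if p.1 < p.2 then (p.2 - 1, p.1) else (p.2, p.1 + 1)) ?_ ?_ ?_ ?_
  · rintro ⟨i, j⟩ hp
    simp only [Finset.mem_product, Finset.mem_range] at hp
    by_cases hij : i < j
    · obtain ⟨j, rfl⟩ : ∃ l, j = l + 1 := ⟨j - 1, by omega⟩
      simp only [hij, if_true, Nat.add_sub_cancel]
      rw [hfg i j (by omega) (by omega), ← add_smul]
      have : (-1 : ℤ) ^ (j + 1) * (-1) ^ i + (-1) ^ i * (-1) ^ j = 0 := by ring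
      rw [this, zero_smul]
    · simp only [hij, if_false]
      rw [hfg j i (by omega) (by omega), ← add_smul]
      have : (-1 : ℤ) ^ j * (-1) ^ i + (-1) ^ (i + 1) * (-1) ^ j = 0 := by ring
      rw [this, zero_smul]
  · rintro ⟨i, j⟩ hp _ h
    by_cases hij : i < j
    · simp only [hij, if_true, Prod.mk.injEq] at h; omega
    · simp only [hij, if_false, Prod.mk.injEq] at h; omega
  · rintro ⟨i, j⟩ hp
    simp only [Finset.mem_product, Finset.mem_range] at hp ⊢
    by_cases hij : i < j
    · simp only [hij, if_true]; omega
    · simp only [hij, if_false]; omega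
  · rintro ⟨i, j⟩ hp
    by_cases hij : i < j
    · have : ¬ (j - 1 < i) := by omega
      simp only [hij, if_true, this, if_false]
      ext <;> simp; omega
    · have : j < i + 1 := by omega
      simp [hij, this]

end AltSum

/-! ### Cyclic cohomology of a cocyclic object in an abelian category -/

section Cyclic

variable {C : Type u} [Category.{v} C] [Preadditive C]

namespace CocyclicData

variable (D : CocyclicData C)

/-- The Hochschild coboundary `b = ∑_{i=0}^{n+1} (-1)^i δ_i : X n ⟶ X (n + 1)`. -/
def b (n : ℕ) : D.X n ⟶ D.X (n + 1) := altSum (n + 2) (D.δ n)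

/-- The operator `b' = ∑_{i=0}^{n} (-1)^i δ_i : X n ⟶ X (n + 1)`, omitting the last coface. -/
def b' (n : ℕ) : D.X n ⟶ D.X (n + 1) := altSum (n + 1) (D.δ n)

/-- The signed cyclic operator `t = (-1)^n τ_n`. -/
def t (n : ℕ) : D.X n ⟶ D.X n := (-1 : ℤ) ^ n • D.τ n

/-- The norm operator `N = 1 + t + ⋯ + t^n`. -/
def N (n : ℕ) : D.X n ⟶ D.X n := ∑ k ∈ Finset.range (n + 1), iter (D.t n) k

/-- The vertical differential of the cyclic bicomplex: `b` in even columns, `b'` in odd columns. -/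
def vert (p q : ℕ) : D.X q ⟶ D.X (q + 1) := if Even p then D.b q else D.b' q

/-- The horizontal differential of the cyclic bicomplex from column `p` to column `p + 1`:
`1 - t` for `p` even, `N` for `p` odd. -/
def horiz (p q : ℕ) : D.X q ⟶ D.X q := if Even p then 𝟙 _ - D.t q else D.N q

variable {D}

lemma iter_zsmul {A : C} (f : A ⟶ A) (c : ℤ) (k : ℕ) : iter (c • f) k = c ^ k • iter f k := by
  induction k with
  | zero => simp [iter]
  | succ k ih =>
    simp only [iter, ih, Preadditive.zsmul_comp, Preadditive.comp_zsmul, smul_smul]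
    rw [pow_succ, mul_comm]

lemma IsCocyclic.b_b (h : D.IsCocyclic) (n : ℕ) : D.b n ≫ D.b (n + 1) = 0 :=
  altSum_comp_altSum _ _ _ fun i j hij hj => h.δ_δ n i j hij (by omega)

lemma IsCocyclic.b'_b' (h : D.IsCocyclic) (n : ℕ) : D.b' n ≫ D.b' (n + 1) = 0 :=
  altSum_comp_altSum _ _ _ fun i j hij hj => h.δ_δ n i j hij (by omega)

lemma IsCocyclic.t_pow (h : D.IsCocyclic) (n : ℕ) : iter (D.t n) (n + 1) = 𝟙 _ := by
  rw [t, iter_zsmul, h.τ_pow, ← pow_mul, (Nat.even_mul_succ_self n).neg_one_pow, one_smul]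

lemma IsCocyclic.t_comp_N (h : D.IsCocyclic) (n : ℕ) : D.t n ≫ D.N n = D.N n := by
  have h1 := Finset.sum_range_succ' (fun k => iter (D.t n) k) (n + 1)
  rw [Finset.sum_range_succ, h.t_pow] at h1
  simp only [iter, add_left_inj] at h1
  rw [N, Preadditive.comp_sum, h1]
  exact Finset.sum_congr rfl fun k _ => iter_comm _ _

lemma N_comp_t (n : ℕ) : D.N n ≫ D.t n = D.t n ≫ D.N n := by
  rw [N, Preadditive.comp_sum, Preadditive.sum_comp]
  exact Finset.sum_congr rfl fun k _ => (iter_comm _ _).symm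

lemma IsCocyclic.horiz_horiz (h : D.IsCocyclic) (p q : ℕ) :
    D.horiz p q ≫ D.horiz (p + 1) q = 0 := by
  unfold horiz
  by_cases hp : Even p
  · have : ¬ Even (p + 1) := by simpa [Nat.even_add_one] using hp
    rw [if_pos hp, if_neg this, Preadditive.sub_comp, Category.id_comp, h.t_comp_N, sub_self]
  · have : Even (p + 1) := by simpa [Nat.even_add_one] using hp
    rw [if_neg hp, if_pos this, Preadditive.comp_sub, Category.comp_id, N_comp_t, h.t_comp_N,
      sub_self]

lemma IsCocyclic.vert_vert (h : D.IsCocyclic) (p q : ℕ) :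
    D.vert p q ≫ D.vert p (q + 1) = 0 := by
  unfold vert
  split_ifs
  · exact h.b_b q
  · exact h.b'_b' q

/-- The signed coface `(-1)^i δ_i`. -/
def sδ (D : CocyclicData C) (n i : ℕ) : D.X n ⟶ D.X (n + 1) := (-1 : ℤ) ^ i • D.δ n i

lemma b_eq (n : ℕ) : D.b n = ∑ i ∈ Finset.range (n + 2), D.sδ n i := rfl

lemma b'_eq (n : ℕ) : D.b' n = ∑ i ∈ Finset.range (n + 1), D.sδ n i := rfl

lemma IsCocyclic.sδ_zero_t (h : D.IsCocyclic) (n : ℕ) :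
    D.sδ n 0 ≫ D.t (n + 1) = D.sδ n (n + 1) := by
  simp only [sδ, t, Preadditive.comp_zsmul, h.δ_zero_τ, pow_zero, one_smul]

lemma IsCocyclic.sδ_succ_t (h : D.IsCocyclic) (n i : ℕ) (hi : i ≤ n) :
    D.sδ n (i + 1) ≫ D.t (n + 1) = D.t n ≫ D.sδ n i := by
  simp only [sδ, t, Preadditive.zsmul_comp, Preadditive.comp_zsmul, h.δ_succ_τ n i hi, smul_smul]
  congr 1
  ring

lemma IsCocyclic.sδ_iter_le (h : D.IsCocyclic) (n j k : ℕ) (hi : j + k ≤ n + 1) :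
    D.sδ n (j + k) ≫ iter (D.t (n + 1)) k = iter (D.t n) k ≫ D.sδ n j := by
  induction k generalizing j with
  | zero => simp [iter]
  | succ k ih =>
    have := ih (j + 1) (by omega)
    rw [show j + (k + 1) = j + 1 + k by omega]
    simp only [iter]
    rw [← Category.assoc, this, Category.assoc, h.sδ_succ_t n j (by omega), Category.assoc]

lemma IsCocyclic.sδ_iter_gt (h : D.IsCocyclic) (n i l : ℕ) (hi : i ≤ n) (hl : i ≤ l)
    (hl' : l ≤ n) :
    D.sδ n i ≫ iter (D.t (n + 1)) (l + 1) = iter (D.t n) l ≫ D.sδ n (n + 1 + i - l) := by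
  obtain ⟨m, rfl⟩ := Nat.exists_eq_add_of_le hl
  have h1 := h.sδ_iter_le n 0 i (by omega)
  have h2 := h.sδ_iter_le n (n + 1 - m) m (by omega)
  rw [zero_add] at h1
  rw [show n + 1 - m + m = n + 1 by omega] at h2
  have e : iter (D.t (n + 1)) (i + m + 1) =
      iter (D.t (n + 1)) i ≫ D.t (n + 1) ≫ iter (D.t (n + 1)) m := by
    rw [iter_comm, add_assoc, iter_add]
    rfl
  rw [e, ← Category.assoc, h1, Category.assoc, ← Category.assoc (D.sδ n 0), h.sδ_zero_t, h2,
    iter_add, Category.assoc]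
  congr 3
  omega

lemma IsCocyclic.b'_N (h : D.IsCocyclic) (n : ℕ) : D.b' n ≫ D.N (n + 1) = D.N n ≫ D.b n := by
  rw [b'_eq, b_eq, N, N]
  simp only [Preadditive.sum_comp, Preadditive.comp_sum]
  rw [← Finset.sum_product', ← Finset.sum_product']
  refine Finset.sum_bij'
    (fun p _ => if p.1 ≤ p.2 then (p.2 - p.1, p.1) else (n + 1 + p.2 - (p.1 - 1), p.1 - 1))
    (fun p _ => if p.1 + p.2 ≤ n then (p.2, p.1 + p.2) else (p.2 + 1, p.1 + p.2 - (n + 1)))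
    ?_ ?_ ?_ ?_ ?_
  · rintro ⟨k, i⟩ hp
    simp only [Finset.mem_product, Finset.mem_range] at hp
    split_ifs <;> simp only [Finset.mem_product, Finset.mem_range] <;> omega
  · rintro ⟨j, l⟩ hp
    simp only [Finset.mem_product, Finset.mem_range] at hp
    split_ifs <;> simp only [Finset.mem_product, Finset.mem_range] <;> omega
  · rintro ⟨k, i⟩ hp
    simp only [Finset.mem_product, Finset.mem_range] at hp
    by_cases hk : k ≤ i
    · have : i - k + k ≤ n := by omega
      simp only [hk, if_true, this, Prod.mk.injEq]
      exact ⟨trivial, by omega⟩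
    · have : ¬ (n + 1 + i - (k - 1) + (k - 1) ≤ n) := by omega
      simp only [hk, if_false, this, Prod.mk.injEq]
      omega
  · rintro ⟨j, l⟩ hp
    simp only [Finset.mem_product, Finset.mem_range] at hp
    by_cases hk : j + l ≤ n
    · have : l ≤ j + l := by omega
      simp only [hk, if_true, this, Prod.mk.injEq]
      exact ⟨by omega, trivial⟩
    · have : ¬ (l + 1 ≤ j + l - (n + 1)) := by omega
      simp only [hk, if_false, this, Prod.mk.injEq]
      omega
  · rintro ⟨k, i⟩ hp
    simp only [Finset.mem_product, Finset.mem_range] at hp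
    by_cases hk : k ≤ i
    · obtain ⟨j, rfl⟩ := Nat.exists_eq_add_of_le' hk
      simp only [hk, if_true, Nat.add_sub_cancel]
      exact h.sδ_iter_le n j k (by omega)
    · obtain ⟨l, rfl⟩ : ∃ l, k = l + 1 := ⟨k - 1, by omega⟩
      simp only [hk, if_false, Nat.add_sub_cancel]
      exact h.sδ_iter_gt n i l (by omega) (by omega) (by omega)

lemma IsCocyclic.b_one_sub_t (h : D.IsCocyclic) (n : ℕ) :
    D.b n ≫ (𝟙 _ - D.t (n + 1)) = (𝟙 _ - D.t n) ≫ D.b' n := by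
  have key : D.b n ≫ D.t (n + 1) = D.t n ≫ D.b' n + D.sδ n (n + 1) := by
    rw [b_eq, Finset.sum_range_succ', Preadditive.add_comp, h.sδ_zero_t, b'_eq,
      Preadditive.comp_sum, Preadditive.sum_comp]
    congr 1
    exact Finset.sum_congr rfl fun i hi => h.sδ_succ_t n i (by simp at hi; omega)
  have e : D.b n = D.b' n + D.sδ n (n + 1) := by rw [b_eq, b'_eq, Finset.sum_range_succ]
  rw [Preadditive.comp_sub, Preadditive.sub_comp, key, Category.comp_id, Category.id_comp, e]
  abel

lemma IsCocyclic.horiz_vert (h : D.IsCocyclic) (p q : ℕ) :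
    D.horiz p q ≫ D.vert (p + 1) q = D.vert p q ≫ D.horiz p (q + 1) := by
  unfold horiz vert
  by_cases hp : Even p
  · have : ¬ Even (p + 1) := by simpa [Nat.even_add_one] using hp
    rw [if_pos hp, if_pos hp, if_neg this, if_pos hp, h.b_one_sub_t]
  · have : Even (p + 1) := by simpa [Nat.even_add_one] using hp
    rw [if_neg hp, if_neg hp, if_pos this, if_neg hp, h.b'_N]

/-- The `p`-th column of the cyclic bicomplex. -/
def IsCocyclic.column (h : D.IsCocyclic) (p : ℕ) : CochainComplex C ℕ :=
  CochainComplex.of D.X (D.vert p) (h.vert_vert p)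

/-- The first-quadrant cyclic bicomplex (Tsygan's bicomplex): its entry in column `p` and row `q` is
`X q`, and its columns and rows are
`X 0 --b--> X 1 --b--> ⋯` (`p` even), `X 0 --b'--> X 1 --b'--> ⋯` (`p` odd) and
`X q --(1-t)--> X q --N--> X q --(1-t)--> ⋯`. All squares commute; the sign `(-1)^p` that is
needed on the vertical differentials is part of the formation of the total complex. -/
def IsCocyclic.cyclicBicomplex (h : D.IsCocyclic) :
    HomologicalComplex₂ C (ComplexShape.up ℕ) (ComplexShape.up ℕ) :=
  CochainComplex.of h.column
    (fun p => CochainComplex.ofHom (fun q => D.horiz p q) fun q => by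
      simpa [column] using h.horiz_vert p q)
    fun p => by
      ext q
      exact h.horiz_horiz p q

end CocyclicData

end Cyclic

section Cohomology

/-- The signs `(-1)^p` for total complexes of first-quadrant bicomplexes of cochains. -/
instance : (ComplexShape.up ℕ).TensorSigns where
  ε' := MonoidHom.mk' (fun (i : ℕ) => (-1 : ℤˣ) ^ i) (pow_add (-1 : ℤˣ))
  rel_add p q r (hpq : p + 1 = q) := show p + r + 1 = q + r by omega
  add_rel p q r (hpq : p + 1 = q) := show r + p + 1 = r + q by omega
  ε'_succ := by
    rintro p _ rfl
    exact (pow_succ (-1 : ℤˣ) p).trans (mul_neg_one _)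

instance {C : Type u} [Category.{v} C] [Preadditive C] [HasFiniteCoproducts C]
    (K : HomologicalComplex₂ C (ComplexShape.up ℕ) (ComplexShape.up ℕ)) :
    K.HasTotal (ComplexShape.up ℕ) := by
  intro n
  have : Finite ((ComplexShape.π (ComplexShape.up ℕ) (ComplexShape.up ℕ) (ComplexShape.up ℕ)) ⁻¹'
      {n}) := by
    refine Set.Finite.subset ((Set.finite_Iic n).prod (Set.finite_Iic n)) ?_
    rintro ⟨p, q⟩ (h : p + q = n)
    simp only [Set.mem_prod, Set.mem_Iic]
    omega
  infer_instance

variable {C : Type u} [Category.{v} C] [Abelian C] {D : CocyclicData C}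

/-- The `n`-th cyclic cohomology object of a cocyclic object: the `n`-th cohomology of the total
complex of its cyclic bicomplex. -/
def CocyclicData.IsCocyclic.cyclicCohomology (h : D.IsCocyclic) (n : ℕ) : C :=
  (h.cyclicBicomplex.total (ComplexShape.up ℕ)).homology n

end Cohomology

/-! ### Hopf algebras in braided monoidal categories -/

section Hopf

variable {C : Type u} [Category.{v} C] [MonoidalCategory C]

/-- The tensor powers `H^0 = I`, `H^{n+1} = H ⊗ H^n`. -/
def tpow (H : C) : ℕ → C
  | 0 => 𝟙_ C
  | n + 1 => H ⊗ tpow H n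

/-- A cocharacter (group-like element) of a coalgebra: a morphism `σ : I ⟶ H` with
`Δ σ = σ ⊗ σ` and `ε σ = id`. -/
structure IsCocharacter (H : C) [ComonObj H] (σ : 𝟙_ C ⟶ H) : Prop where
  comul : σ ≫ Δ[H] = (λ_ (𝟙_ C)).inv ≫ (σ ⊗ₘ σ)
  counit : σ ≫ ε[H] = 𝟙 (𝟙_ C)

/-- A character of an algebra: a morphism `δ : H ⟶ I` with `δ m = δ ⊗ δ` and `δ η = id`. -/
structure IsCharacter (H : C) [MonObj H] (δ : H ⟶ 𝟙_ C) : Prop where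
  mul : μ[H] ≫ δ = (δ ⊗ₘ δ) ≫ (λ_ (𝟙_ C)).hom
  one : η[H] ≫ δ = 𝟙 (𝟙_ C)

/-- The cofaces `H^n ⟶ H^{n+1}` attached to morphisms `α β : I ⟶ H` : the `0`-th one is
`(α, 1, …, 1)`, the `i`-th one for `1 ≤ i ≤ n` is `(1, …, Δ, …, 1)` with `Δ` applied to the `i`-th
factor, and the `(n+1)`-st one is `(1, …, 1, β)`. (The value for `i > n + 1` is irrelevant.) -/
def coface (H : C) [ComonObj H] (α β : 𝟙_ C ⟶ H) : ∀ n : ℕ, ℕ → (tpow H n ⟶ tpow H (n + 1))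
  | n, 0 => (λ_ (tpow H n)).inv ≫ α ▷ tpow H n
  | 0, _ + 1 => (λ_ (𝟙_ C)).inv ≫ β ▷ 𝟙_ C
  | n + 1, 1 => Δ[H] ▷ tpow H n ≫ (α_ H H (tpow H n)).hom
  | n + 1, i + 2 => H ◁ coface H α β n (i + 1)

/-- The codegeneracies `H^{n+1} ⟶ H^n`: `(1, …, ε, …, 1)` with `ε` applied to the `(i+1)`-st factor,
for `0 ≤ i ≤ n`. (The value for `i > n` is irrelevant.) -/
def codegen (H : C) [ComonObj H] : ∀ n : ℕ, ℕ → (tpow H (n + 1) ⟶ tpow H n)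
  | n, 0 => ε[H] ▷ tpow H n ≫ (λ_ (tpow H n)).hom
  | 0, _ + 1 => ε[H] ▷ 𝟙_ C ≫ (λ_ (𝟙_ C)).hom
  | n + 1, i + 1 => H ◁ codegen H n i

/-- The iterated comultiplication `Δ^{n-1} : H ⟶ H^n` (for `n = 0` it is the counit, and for `n = 1`
the identity up to `H ≅ H ⊗ I`). -/
def iterComul (H : C) [ComonObj H] : ∀ n : ℕ, H ⟶ tpow H n
  | 0 => ε[H]
  | n + 1 => Δ[H] ≫ H ◁ iterComul H n

lemma insert_comp (H : C) (α : 𝟙_ C ⟶ H) {X Y : C} (f : X ⟶ Y) :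
    ((λ_ X).inv ≫ α ▷ X) ≫ H ◁ f = f ≫ (λ_ Y).inv ≫ α ▷ Y := by
  rw [Category.assoc, ← whisker_exchange, leftUnitor_inv_naturality_assoc]

lemma insert_comul (H : C) [ComonObj H] {α : 𝟙_ C ⟶ H} (hα : IsCocharacter H α) (X : C) :
    ((λ_ X).inv ≫ α ▷ X) ≫ Δ[H] ▷ X ≫ (α_ H H X).hom =
      ((λ_ X).inv ≫ α ▷ X) ≫ (λ_ (H ⊗ X)).inv ≫ α ▷ (H ⊗ X) := by
  rw [← insert_comp, Category.assoc, ← comp_whiskerRight_assoc, hα.comul,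
    MonoidalCategory.tensorHom_def]
  monoidal

lemma comul_comul (H : C) [ComonObj H] (X : C) :
    (Δ[H] ▷ X ≫ (α_ H H X).hom) ≫ H ◁ (Δ[H] ▷ X ≫ (α_ H H X).hom) =
      (Δ[H] ▷ X ≫ (α_ H H X).hom) ≫ Δ[H] ▷ (H ⊗ X) ≫ (α_ H H (H ⊗ X)).hom := by
  have h := congrArg (fun f => f ▷ X ≫ (α_ H (H ⊗ H) X).hom ≫ H ◁ (α_ H H X).hom)
    (ComonObj.comul_assoc H)
  simp only [comp_whiskerRight, Category.assoc] at h
  simp only [whiskerLeft_comp, Category.assoc]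
  rw [← associator_naturality_middle_assoc, h]
  monoidal

lemma comul_comp (H : C) [ComonObj H] {X Y : C} (f : X ⟶ Y) :
    (Δ[H] ▷ X ≫ (α_ H H X).hom) ≫ H ◁ H ◁ f = H ◁ f ≫ Δ[H] ▷ Y ≫ (α_ H H Y).hom := by
  rw [whisker_exchange_assoc]
  simp

lemma coface_comp_coface (H : C) [ComonObj H] {α β : 𝟙_ C ⟶ H} (hα : IsCocharacter H α)
    (hβ : IsCocharacter H β) : ∀ n i j : ℕ, i ≤ j → j ≤ n + 1 →
      coface H α β n i ≫ coface H α β (n + 1) (j + 1) =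
        coface H α β n j ≫ coface H α β (n + 1) i
  | n, 0, 0, _, _ => by
    cases n <;> exact insert_comul H hα _
  | n, 0, j + 1, _, _ => by
    cases n <;> exact insert_comp H α (coface H α β _ (j + 1))
  | 0, i + 1, j + 1, h1, h2 => by
    obtain rfl : j = 0 := by omega
    obtain rfl : i = 0 := by omega
    exact (insert_comp H β ((λ_ (𝟙_ C)).inv ≫ β ▷ 𝟙_ C)).trans (insert_comul H hβ _).symm
  | n + 1, 1, 1, _, _ => comul_comul H (tpow H n)
  | n + 1, 1, j + 2, _, _ => comul_comp H (coface H α β n (j + 1))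
  | n + 1, i + 2, j + 2, h1, h2 =>
    ((whiskerLeft_comp H _ _).symm.trans (congrArg (fun f => H ◁ f)
      (coface_comp_coface H hα hβ n (i + 1) (j + 1) (by omega) (by omega)))).trans
      (whiskerLeft_comp H _ _)

section Braided

variable [BraidedCategory C]

/-- The multiplication `m_n : H^n ⊗ H^n ⟶ H^n` of the `n`-th tensor power of an algebra `H`:
`(a_1, …, a_n) ⊗ (b_1, …, b_n) ↦ (a_1 b_1, …, a_n b_n)`, where the factors are shuffled by means of
the braiding. -/
def mulPow (H : C) [MonObj H] : ∀ n : ℕ, tpow H n ⊗ tpow H n ⟶ tpow H n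
  | 0 => (λ_ (𝟙_ C)).hom
  | n + 1 => tensorμ H (tpow H n) H (tpow H n) ≫ (μ[H] ⊗ₘ mulPow H n)

/-- The twisted antipode `(δ ⊗ S) Δ`. -/
def twistedAntipode (H : C) [HopfObj H] (δ : H ⟶ 𝟙_ C) : H ⟶ H :=
  Δ[H] ≫ (δ ⊗ₘ 𝒮[H]) ≫ (λ_ H).hom

/-- A braided modular pair in involution: a character `δ` and a cocharacter `σ` such that
`δ σ = id` and `m (m ⊗ id) (S σ ⊗ S̃² ⊗ σ) = id`, where `S̃` is the `δ`-twisted antipode. -/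
structure IsModularPairInInvolution (H : C) [HopfObj H] (δ : H ⟶ 𝟙_ C) (σ : 𝟙_ C ⟶ H) : Prop where
  character : IsCharacter H δ
  cocharacter : IsCocharacter H σ
  modular : σ ≫ δ = 𝟙 (𝟙_ C)
  involution :
    (ρ_ H).inv ≫ (λ_ H).inv ▷ 𝟙_ C ≫
      (((σ ≫ 𝒮[H]) ⊗ₘ (twistedAntipode H δ ≫ twistedAntipode H δ)) ⊗ₘ σ) ≫
        μ[H] ▷ H ≫ μ[H] = 𝟙 H

/-- The cyclic operators `τ_0 = id` and `τ_n = m_n (Δ^{n-1} S̃, 1_{H^{n-1}}, σ)` for `n ≥ 1`. -/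
def cyclicOp (H : C) [HopfObj H] (δ : H ⟶ 𝟙_ C) (σ : 𝟙_ C ⟶ H) : ∀ n : ℕ, tpow H n ⟶ tpow H n
  | 0 => 𝟙 (𝟙_ C)
  | n + 1 => ((twistedAntipode H δ ≫ iterComul H (n + 1)) ⊗ₘ coface H η[H] σ n (n + 1)) ≫
      mulPow H (n + 1)

/-- The braided Connes–Moscovici cocyclic object of a braided Hopf algebra `H` with respect to
`(δ, σ)`: the objects are `H^n` (with `H^0 = I`), the cofaces are `(η, 1, …, 1)`, `(1, …, Δ, …, 1)`
and `(1, …, 1, σ)`. -/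
def hopfCocyclicData (H : C) [HopfObj H] (δ : H ⟶ 𝟙_ C) (σ : 𝟙_ C ⟶ H) : CocyclicData C where
  X := tpow H
  δ := coface H η[H] σ
  σ := codegen H
  τ := cyclicOp H δ σ

end Braided

section Hochschild

variable [Preadditive C]

/-- The Hochschild cochain complex of a coalgebra `H` with coefficients in the unit object `I`,
regarded as an `H`-bicomodule by means of two cocharacters `α` and `β` (the `H`-coactions
`I ⟶ I ⊗ H = H` and `I ⟶ H ⊗ I = H` of `I`):
the cochains of degree `n` are `I ⊗ H^n = H^n`, and the differential is
`(α, 1, …, 1) + ∑_{i=1}^n (-1)^i (1, …, Δ, …, 1) + (-1)^{n+1} (1, …, 1, β)`. -/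
def hochschildComplex (H : C) [ComonObj H] {α β : 𝟙_ C ⟶ H} (hα : IsCocharacter H α)
    (hβ : IsCocharacter H β) : CochainComplex C ℕ :=
  CochainComplex.of (tpow H) (fun n => altSum (n + 2) (coface H α β n)) fun n =>
    altSum_comp_altSum _ _ _ fun i j hij hj => coface_comp_coface H hα hβ n i j hij (by omega)

end Hochschild

/-- The unit of a braided bialgebra is a cocharacter. -/
lemma isCocharacter_one [BraidedCategory C] (H : C) [BimonObj H] : IsCocharacter H η[H] where
  comul := by rw [BimonObj.one_comul]; rfl
  counit := BimonObj.one_counit H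

/-- The Hochschild cohomology `HH^n(H, I)` of the coalgebra underlying a braided bialgebra `H`, with
coefficients in the trivial `H`-bicomodule `I` (both coactions are given by the unit `η` of `H`). -/
def hochschildCohomology {C : Type u} [Category.{v} C] [Abelian C] [MonoidalCategory C]
    [BraidedCategory C] (H : C) [BimonObj H] (n : ℕ) : C :=
  (hochschildComplex H (isCocharacter_one H) (isCocharacter_one H)).homology n

end Hopf

end HopfCyclic

end

attribute [local instance] CategoryTheory.Abelian.hasFiniteBiproducts

/-!
Let `G` be the affine group scheme with coordinate ring `H`. In the homogeneous coordinates
`g_k = a_0 ⋯ a_{k-1}`, `H^n` is the ring of functions on the quotient of `Map({0, …, n}, G)` by left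
translation. So `n ↦ H^n` extends to a functor on the category of the sets `{0, …, n}` and *all*
maps between them, and `δ_i`, `σ_i`, `τ_n` are the images of the face maps, the degeneracies and the
cyclic rotations. This makes `(H^n)` cocyclic.

In the linear completion of the category of the sets `{0, …, n}`, coning with apex `0` contracts
the simplices. As in the method of acyclic models, the identity of column zero can therefore be
extended, degree by degree, to a natural section of the projection of the total complex to column
zero, and this section is transported to `C` by the functor above. The kernel of the projection
consists of the columns `p ≥ 1`. Column one is contracted by the last codegeneracy, and the columns
`p ≥ 2` form a copy of the total complex shifted by two, so `HC^n ≅ HH^n ⊕ HC^(n-2)`.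
-/

universe v' u'

noncomputable section

namespace HopfCyclic

/-! ### Points of commutative Hopf algebras -/

section MonHom

variable {C : Type u} [Category.{v} C] [MonoidalCategory C]

lemma conv_mul_eq_tensorHom {M N : C} [ComonObj M] [MonObj N] (f g : Conv M N) :
    f * g = Δ[M] ≫ ((show M ⟶ N from f) ⊗ₘ (show M ⟶ N from g)) ≫ μ[N] := by
  rw [Conv.mul_eq, MonoidalCategory.tensorHom_def, Category.assoc]

section Symmetric

variable [SymmetricCategory C]

instance isMonHom_mul (R : C) [MonObj R] [IsCommMonObj R] : IsMonHom μ[R] where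
  one_hom := by
    rw [MonObj.tensorObj.one_def]
    simp [MonoidalCategory.tensorHom_def, ← unitors_equal]
  mul_hom := by simp [MonObj.tensorObj.mul_def]

instance isMonHom_antipode (H : C) [HopfObj H] [IsCommMonObj H] : IsMonHom 𝒮[H] where
  one_hom := by simp
  mul_hom := by rw [HopfObj.mul_antipode, IsCommMonObj.mul_comm]

end Symmetric

variable [BraidedCategory C]

instance isMonHom_one (R : C) [MonObj R] : IsMonHom η[R] where
  mul_hom := by simp [MonoidalCategory.tensorHom_def, ← unitors_equal]

instance isMonHom_comul (H : C) [BimonObj H] : IsMonHom Δ[H] where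
  mul_hom := by simp [MonObj.tensorObj.mul_def]

instance isMonHom_counit (H : C) [BimonObj H] : IsMonHom ε[H] where

end MonHom

section Points

variable {C : Type u} [Category.{v} C] [MonoidalCategory C] [SymmetricCategory C]

/-- The `R`-points of a bialgebra `H`: the monoid morphisms `H ⟶ R`, which form a submonoid of the
convolution monoid. For commutative Hopf `H` this is the group of `R`-points of the affine group
scheme represented by `H`. -/
def points (H R : C) [BimonObj H] [MonObj R] [IsCommMonObj R] : Submonoid (Conv H R) where
  carrier := {f | IsMonHom (show H ⟶ R from f)}
  one_mem' := inferInstanceAs (IsMonHom (ε[H] ≫ η[R]))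
  mul_mem' {f g} (hf : IsMonHom (show H ⟶ R from f)) (hg : IsMonHom (show H ⟶ R from g)) := by
    rw [Set.mem_ofPred_eq, conv_mul_eq_tensorHom]
    infer_instance

namespace points

variable {H R R' : C} [MonObj R] [IsCommMonObj R] [MonObj R'] [IsCommMonObj R']

section Bimon

variable [BimonObj H]

/-- The monoid morphism underlying a point. -/
def hom (a : points H R) : H ⟶ R := a.1

instance (a : points H R) : IsMonHom (hom a) := a.2

/-- The point given by a monoid morphism. -/
def mk (f : H ⟶ R) [hf : IsMonHom f] : points H R := ⟨f, hf⟩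

lemma hom_one : hom (1 : points H R) = ε[H] ≫ η[R] := rfl

lemma hom_mul (a b : points H R) : hom (a * b) = Δ[H] ≫ (hom a ⊗ₘ hom b) ≫ μ[R] :=
  conv_mul_eq_tensorHom _ _

lemma hom_injective : Function.Injective (hom : points H R → (H ⟶ R)) := Subtype.val_injective

/-- Functoriality of the monoid of points in `R`. -/
def map (φ : R ⟶ R') [IsMonHom φ] : points H R →* points H R' where
  toFun a := mk (hom a ≫ φ)
  map_one' := hom_injective <| by
    change (ε[H] ≫ η[R]) ≫ φ = ε[H] ≫ η[R']
    rw [Category.assoc, IsMonHom.one_hom]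
  map_mul' a b := hom_injective <| by
    refine Eq.trans ?_ (hom_mul _ _).symm
    change hom (a * b) ≫ φ = Δ[H] ≫ (hom a ≫ φ ⊗ₘ hom b ≫ φ) ≫ μ[R']
    simp [hom_mul]

lemma hom_map (φ : R ⟶ R') [IsMonHom φ] (a : points H R) : hom (map φ a) = hom a ≫ φ := rfl

end Bimon

variable [HopfObj H] [IsCommMonObj H]

instance : Group (points H R) where
  inv a := mk (𝒮[H] ≫ hom a)
  inv_mul_cancel a := hom_injective <| by
    rw [hom_mul, hom_one]
    change Δ[H] ≫ ((𝒮[H] ≫ hom a) ⊗ₘ hom a) ≫ μ[R] = ε[H] ≫ η[R]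
    rw [← IsMonHom.one_hom (hom a), ← HopfObj.antipode_left_assoc, IsMonHom.mul_hom,
      whiskerRight_comp_tensorHom_assoc]

lemma hom_inv (a : points H R) : hom a⁻¹ = 𝒮[H] ≫ hom a := rfl

end points

end Points

/-! ### Tensor powers as coproducts -/

section Copair

variable {C : Type u} [Category.{v} C] [MonoidalCategory C]

/-- The inclusion `A ⟶ A ⊗ B` of the first factor of a tensor product of monoids. -/
def inl (A B : C) [MonObj B] : A ⟶ A ⊗ B := (ρ_ A).inv ≫ A ◁ η[B]

/-- The inclusion `B ⟶ A ⊗ B` of the second factor of a tensor product of monoids. -/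
def inr (A B : C) [MonObj A] : B ⟶ A ⊗ B := (λ_ B).inv ≫ η[A] ▷ B

/-- The morphism `A ⊗ B ⟶ R` with components `f` and `g`: the copairing, if `R` is commutative. -/
def copair {A B R : C} [MonObj R] (f : A ⟶ R) (g : B ⟶ R) : A ⊗ B ⟶ R := (f ⊗ₘ g) ≫ μ[R]

variable {A B R R' : C} [MonObj R] [MonObj R']

lemma inl_copair [MonObj B] (f : A ⟶ R) (g : B ⟶ R) [IsMonHom g] :
    inl A B ≫ copair f g = f := by
  rw [inl, copair, Category.assoc, whiskerLeft_comp_tensorHom_assoc, IsMonHom.one_hom,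
    MonObj.mul_one_hom, Iso.inv_hom_id_assoc]

lemma inr_copair [MonObj A] (f : A ⟶ R) [IsMonHom f] (g : B ⟶ R) :
    inr A B ≫ copair f g = g := by
  rw [inr, copair, Category.assoc, whiskerRight_comp_tensorHom_assoc, IsMonHom.one_hom,
    MonObj.one_mul_hom, Iso.inv_hom_id_assoc]

lemma whiskerLeft_copair {B' : C} (f : A ⟶ R) (h : B' ⟶ B) (g : B ⟶ R) :
    A ◁ h ≫ copair f g = copair f (h ≫ g) := by
  rw [copair, copair, whiskerLeft_comp_tensorHom_assoc]

lemma copair_counit_one [ComonObj A] (g : B ⟶ R) :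
    copair (ε[A] ≫ η[R]) g = (ε[A] ▷ B ≫ (λ_ B).hom) ≫ g := by
  rw [Category.assoc, ← MonObj.one_mul_hom, whiskerRight_comp_tensorHom_assoc, copair]

lemma comul_whiskerRight_copair {H : C} [ComonObj H] (f g : H ⟶ R) (h : B ⟶ R) :
    (Δ[H] ▷ B ≫ (α_ H H B).hom) ≫ copair f (copair g h) = copair (Δ[H] ≫ copair f g) h := by
  simp only [copair, mon_tauto]

lemma copair_comp (f : A ⟶ R) (g : B ⟶ R) (φ : R ⟶ R') [IsMonHom φ] :
    copair f g ≫ φ = copair (f ≫ φ) (g ≫ φ) := by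
  rw [copair, copair, Category.assoc, IsMonHom.mul_hom, tensorHom_comp_tensorHom_assoc]

section Braided

variable [BraidedCategory C]

lemma copair_inl_inr (A B : C) [MonObj A] [MonObj B] :
    copair (inl A B) (inr A B) = 𝟙 (A ⊗ B) := by
  rw [copair, inl, inr, MonObj.tensorObj.mul_def, ← tensorHom_comp_tensorHom, ← id_tensorHom,
    ← tensorHom_id, Category.assoc, tensorμ_natural_assoc, tensorHom_comp_tensorHom, id_tensorHom,
    tensorHom_id, MonObj.one_mul, MonObj.mul_one]
  simp only [tensorμ, braiding_tensorUnit_left]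
  monoidal

end Braided

section Symmetric

variable [SymmetricCategory C]

instance isMonHom_inl (A B : C) [MonObj A] [MonObj B] : IsMonHom (inl A B) :=
  inferInstanceAs (IsMonHom ((ρ_ A).inv ≫ A ◁ η[B]))

instance isMonHom_inr (A B : C) [MonObj A] [MonObj B] : IsMonHom (inr A B) :=
  inferInstanceAs (IsMonHom ((λ_ B).inv ≫ η[A] ▷ B))

instance isMonHom_copair [MonObj A] [MonObj B] [IsCommMonObj R] (f : A ⟶ R) (g : B ⟶ R)
    [IsMonHom f] [IsMonHom g] : IsMonHom (copair f g) :=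
  inferInstanceAs (IsMonHom ((f ⊗ₘ g) ≫ μ[R]))

end Symmetric

end Copair

section TensorPower

variable {C : Type u} [Category.{v} C] [MonoidalCategory C] [SymmetricCategory C]

instance tpowMonObj (H : C) [MonObj H] : ∀ n, MonObj (tpow H n)
  | 0 => inferInstanceAs (MonObj (𝟙_ C))
  | n + 1 => letI := tpowMonObj H n; inferInstanceAs (MonObj (H ⊗ tpow H n))

instance tpowIsCommMonObj (H : C) [MonObj H] [IsCommMonObj H] : ∀ n, IsCommMonObj (tpow H n)
  | 0 => inferInstanceAs (IsCommMonObj (𝟙_ C))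
  | n + 1 => letI := tpowIsCommMonObj H n; inferInstanceAs (IsCommMonObj (H ⊗ tpow H n))

lemma mulPow_eq_mul (H : C) [MonObj H] : ∀ n, mulPow H n = μ[tpow H n]
  | 0 => rfl
  | n + 1 => by
    rw [mulPow, mulPow_eq_mul H n]
    rfl

variable {H R R' : C} [BimonObj H] [MonObj R] [IsCommMonObj R] [MonObj R'] [IsCommMonObj R']

/-- The morphism `H^n ⟶ R` with components the given points: it exhibits `H^n` as the `n`-fold
coproduct of `H` among commutative monoids. -/
def tpowDesc : ∀ {n : ℕ}, (Fin n → points H R) → (tpow H n ⟶ R)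
  | 0, _ => η[R]
  | _ + 1, a => copair (points.hom (a 0)) (tpowDesc (Fin.tail a))

instance isMonHom_tpowDesc : ∀ {n : ℕ} (a : Fin n → points H R), IsMonHom (tpowDesc a)
  | 0, _ => isMonHom_one R
  | _ + 1, a =>
    have := isMonHom_tpowDesc (Fin.tail a)
    isMonHom_copair (points.hom (a 0)) (tpowDesc (Fin.tail a))

lemma tpowDesc_comp (φ : R ⟶ R') [IsMonHom φ] : ∀ {n : ℕ} (a : Fin n → points H R),
    tpowDesc a ≫ φ = tpowDesc (points.map φ ∘ a)
  | 0, _ => IsMonHom.one_hom φ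
  | _ + 1, a => (copair_comp _ _ φ).trans (congrArg _ (tpowDesc_comp φ (Fin.tail a)))

variable [IsCommMonObj H]

variable (H) in
/-- The tautological points of `H^n`, given by the inclusions of its factors. -/
def tautPoint : ∀ n : ℕ, Fin n → points H (tpow H n)
  | 0 => Fin.elim0
  | n + 1 => Fin.cons (points.mk (R := H ⊗ tpow H n) (inl H (tpow H n)))
      (points.map (inr H (tpow H n)) ∘ tautPoint n)

lemma tpowDesc_tautPoint : ∀ n : ℕ, tpowDesc (tautPoint H n) = 𝟙 (tpow H n)
  | 0 => rfl
  | n + 1 => by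
    have h : tpowDesc (points.map (inr H (tpow H n)) ∘ tautPoint H n) = inr H (tpow H n) := by
      rw [← tpowDesc_comp, tpowDesc_tautPoint n, Category.id_comp]
    exact (congrArg (copair (inl H (tpow H n))) h).trans (copair_inl_inr H (tpow H n))

lemma map_tpowDesc_tautPoint : ∀ {n : ℕ} (a : Fin n → points H R),
    points.map (tpowDesc a) ∘ tautPoint H n = a
  | 0, _ => Subsingleton.elim _ _
  | n + 1, a => by
    funext k
    refine points.hom_injective ?_
    induction k using Fin.cases with
    | zero => exact inl_copair _ _
    | succ k =>
      calc points.hom (points.map (inr H (tpow H n)) (tautPoint H n k)) ≫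
            copair (points.hom (a 0)) (tpowDesc (Fin.tail a))
          = points.hom (tautPoint H n k) ≫ tpowDesc (Fin.tail a) := by
            rw [points.hom_map, Category.assoc, inr_copair]
        _ = points.hom (a k.succ) :=
            congrArg points.hom (congrFun (map_tpowDesc_tautPoint (Fin.tail a)) k)

end TensorPower

section Reindex

variable {G G' : Type*} [Group G] [Group G']

/-- The action of maps of vertex sets on tuples: in the homogeneous coordinates
`g_k = a_0 ⋯ a_{k-1}`, which are determined up to left translation, `a` is sent to the tuple with
homogeneous coordinates `g ∘ f`. -/
def reindex {m n : ℕ} (f : Fin (m + 1) → Fin (n + 1)) (a : Fin n → G) (k : Fin m) : G :=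
  (Fin.partialProd a (f k.castSucc))⁻¹ * Fin.partialProd a (f k.succ)

lemma partialProd_reindex {m n : ℕ} (f : Fin (m + 1) → Fin (n + 1)) (a : Fin n → G)
    (k : Fin (m + 1)) : Fin.partialProd (reindex f a) k =
      (Fin.partialProd a (f 0))⁻¹ * Fin.partialProd a (f k) := by
  induction k using Fin.induction with
  | zero => simp
  | succ k ih => rw [Fin.partialProd_succ, ih, reindex]; group

lemma reindex_reindex {l m n : ℕ} (f : Fin (l + 1) → Fin (m + 1)) (g : Fin (m + 1) → Fin (n + 1))
    (a : Fin n → G) : reindex f (reindex g a) = reindex (g ∘ f) a := by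
  funext k
  rw [reindex, partialProd_reindex, partialProd_reindex, reindex, Function.comp_apply,
    Function.comp_apply]
  group

lemma reindex_id {n : ℕ} (a : Fin n → G) : reindex id a = a :=
  funext fun k => Fin.partialProd_right_inv a k

lemma reindex_castSucc {n : ℕ} (a : Fin (n + 1) → G) : reindex Fin.castSucc a = Fin.init a := by
  funext k
  rw [reindex, ← Fin.succ_castSucc, Fin.partialProd_right_inv]
  rfl

lemma reindex_succ_comp {m n : ℕ} (f : Fin (m + 1) → Fin (n + 1)) (a : Fin (n + 1) → G) :
    reindex (Fin.succ ∘ f) a = reindex f (Fin.tail a) := by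
  funext k
  rw [reindex, reindex, Function.comp_apply, Function.comp_apply, Fin.partialProd_succ',
    Fin.partialProd_succ']
  group

lemma reindex_succ {n : ℕ} (a : Fin (n + 1) → G) : reindex Fin.succ a = Fin.tail a :=
  (reindex_succ_comp id a).trans (reindex_id _)

lemma reindex_cons {m n : ℕ} (j : Fin (n + 1)) (f : Fin (m + 1) → Fin (n + 1)) (a : Fin n → G) :
    reindex (Fin.cons j f : Fin (m + 2) → Fin (n + 1)) a =
      Fin.cons ((Fin.partialProd a j)⁻¹ * Fin.partialProd a (f 0)) (reindex f a) := by
  funext k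
  induction k using Fin.cases with
  | zero => rfl
  | succ k => simp [reindex]

lemma reindex_cons_zero_succ_comp {m n : ℕ} (f : Fin (m + 1) → Fin (n + 1)) (a : Fin (n + 1) → G) :
    reindex (Fin.cons 0 (Fin.succ ∘ f) : Fin (m + 2) → Fin (n + 2)) a =
      Fin.cons (a 0 * Fin.partialProd (Fin.tail a) (f 0)) (reindex f (Fin.tail a)) := by
  rw [reindex_cons, reindex_succ_comp, Function.comp_apply, Fin.partialProd_zero,
    Fin.partialProd_succ', inv_one, one_mul]

lemma map_comp_reindex {m n : ℕ} (φ : G →* G') (f : Fin (m + 1) → Fin (n + 1)) (a : Fin n → G) :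
    φ ∘ reindex f a = reindex f (φ ∘ a) := by
  have h (k : Fin (n + 1)) : φ (Fin.partialProd a k) = Fin.partialProd (φ ∘ a) k := by
    induction k using Fin.induction with
    | zero => simp
    | succ k ih => simp [Fin.partialProd_succ, ih]
  funext k
  simp [reindex, h]

end Reindex

/-! ### The category of finite vertex sets -/

section VertexCat

/-- The coface map `{0, …, n} → {0, …, n + 1}` that skips `i` (the last one for `i > n`). -/
def cofaceMap (n i : ℕ) (k : Fin (n + 1)) : Fin (n + 2) := if k < i then k.castSucc else k.succ

/-- The codegeneracy map `{0, …, n + 1} → {0, …, n}` that hits `i` twice (the last one for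
`i > n`). -/
def codegenMap (n i : ℕ) (k : Fin (n + 2)) : Fin (n + 1) :=
  ⟨if k ≤ i then min k n else k - 1, by split_ifs <;> omega⟩

/-- The rotation `0 ↦ n`, `k + 1 ↦ k` of `{0, …, n}`. -/
def rotationMap (n : ℕ) : Fin (n + 1) → Fin (n + 1) := Fin.cons (Fin.last n) Fin.castSucc

lemma val_cofaceMap (n i : ℕ) (k : Fin (n + 1)) :
    (cofaceMap n i k : ℕ) = if (k : ℕ) < i then (k : ℕ) else k + 1 := by
  rw [cofaceMap]
  split_ifs <;> rfl

lemma val_rotationMap (n : ℕ) (k : Fin (n + 1)) :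
    (rotationMap n k : ℕ) = if (k : ℕ) = 0 then n else k - 1 := by
  induction k using Fin.cases <;> simp [rotationMap]

lemma cofaceMap_zero (n : ℕ) : cofaceMap n 0 = Fin.succ := rfl

lemma cofaceMap_last (n : ℕ) : cofaceMap n (n + 1) = Fin.castSucc :=
  funext fun k => if_pos k.isLt

lemma cofaceMap_succ (n i : ℕ) :
    cofaceMap (n + 1) (i + 1) = Fin.cons 0 (Fin.succ ∘ cofaceMap n i) := by
  funext k
  induction k using Fin.cases with
  | zero => simp [cofaceMap]
  | succ k => ext; simp [val_cofaceMap]; grind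

lemma codegenMap_zero (n : ℕ) : codegenMap n 0 = Fin.cons 0 id := by
  funext k
  induction k using Fin.cases <;> simp [codegenMap]

lemma codegenMap_succ (n i : ℕ) :
    codegenMap (n + 1) (i + 1) = Fin.cons 0 (Fin.succ ∘ codegenMap n i) := by
  funext k
  induction k using Fin.cases with
  | zero => simp [codegenMap]
  | succ k => ext; simp [codegenMap]; grind

lemma iterate_rotationMap {n : ℕ} (k : Fin (n + 1)) {j : ℕ} (hj : j ≤ n + 1) :
    ((rotationMap n)^[j] k : ℕ) = if j ≤ (k : ℕ) then (k : ℕ) - j else k + (n + 1) - j := by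
  induction j with
  | zero => simp
  | succ j ih =>
    rw [Function.iterate_succ_apply', val_rotationMap, ih (by omega)]
    grind

/-- The category of the nonempty finite sets `{0, …, n}` and all maps between them. -/
structure VertexCat where
  of ::
  /-- The last element of the set. -/
  dim : ℕ

namespace VertexCat

instance : Category VertexCat where
  Hom m n := Fin (m.dim + 1) → Fin (n.dim + 1)
  id _ := id
  comp f g := g ∘ f

lemma hom_ext {m n : VertexCat} {f g : m ⟶ n} (h : ∀ k, (f k : ℕ) = (g k : ℕ)) : f = g :=
  funext fun k => Fin.ext (h k)

lemma comp_apply {l m n : VertexCat} (f : l ⟶ m) (g : m ⟶ n) (k : Fin (l.dim + 1)) :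
    (f ≫ g) k = g (f k) := rfl

/-- The cocyclic object formed by the sets `{0, …, n}`. -/
def cocyclic : CocyclicData VertexCat where
  X := of
  δ := cofaceMap
  σ := codegenMap
  τ := rotationMap

lemma val_id (n : ℕ) (k : Fin (n + 1)) : ((𝟙 (cocyclic.X n) : of n ⟶ of n) k : ℕ) = k := rfl

lemma iter_apply {n : VertexCat} (f : n ⟶ n) (j : ℕ) (k : Fin (n.dim + 1)) :
    iter f j k = f^[j] k := by
  induction j with
  | zero => rfl
  | succ j ih => rw [iter, comp_apply, ih, Function.iterate_succ_apply']

lemma val_δ (n i : ℕ) (k : Fin (n + 1)) :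
    (cocyclic.δ n i k : ℕ) = if (k : ℕ) < i then (k : ℕ) else k + 1 := val_cofaceMap n i k

lemma val_σ (n i : ℕ) (k : Fin (n + 2)) :
    (cocyclic.σ n i k : ℕ) = if (k : ℕ) ≤ i then min (k : ℕ) n else k - 1 := rfl

lemma val_τ (n : ℕ) (k : Fin (n + 1)) :
    (cocyclic.τ n k : ℕ) = if (k : ℕ) = 0 then n else k - 1 := val_rotationMap n k

lemma isCocyclic_cocyclic : cocyclic.IsCocyclic where
  δ_δ n i j _ _ := hom_ext fun k => by grind [comp_apply, val_δ]
  σ_σ n i j _ _ := hom_ext fun (k : Fin (n + 3)) => by grind [comp_apply, val_σ]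
  δ_σ_lt n i j _ _ := hom_ext fun (k : Fin (n + 2)) => by grind [comp_apply, val_δ, val_σ]
  δ_σ_self n i _ := hom_ext fun (k : Fin (n + 1)) => by grind [comp_apply, val_id, val_δ, val_σ]
  δ_σ_succ n i _ := hom_ext fun (k : Fin (n + 1)) => by grind [comp_apply, val_id, val_δ, val_σ]
  δ_σ_gt n i j _ _ := hom_ext fun (k : Fin (n + 2)) => by grind [comp_apply, val_δ, val_σ]
  δ_zero_τ n := hom_ext fun (k : Fin (n + 1)) => by grind [comp_apply, val_δ, val_τ]
  δ_succ_τ n i _ := hom_ext fun (k : Fin (n + 1)) => by grind [comp_apply, val_δ, val_τ]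
  σ_zero_τ n := hom_ext fun (k : Fin (n + 2)) => by grind [comp_apply, val_σ, val_τ]
  σ_succ_τ n i _ := hom_ext fun (k : Fin (n + 2)) => by grind [comp_apply, val_σ, val_τ]
  τ_pow n := hom_ext fun (k : Fin (n + 1)) => by
    exact (congrArg Fin.val (iter_apply (n := of n) _ _ k)).trans
      ((iterate_rotationMap k le_rfl).trans (by grind [val_id]))

end VertexCat

end VertexCat

/-! ### The functor defined by a commutative Hopf algebra -/

section Map

variable {C : Type u} [Category.{v} C] {E : Type u'} [Category.{v'} E]

lemma map_iter (F : C ⥤ E) {A : C} (f : A ⟶ A) (k : ℕ) : F.map (iter f k) = iter (F.map f) k := by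
  induction k with
  | zero => exact F.map_id A
  | succ k ih => rw [iter, iter, F.map_comp, ih]

namespace CocyclicData

/-- The image of cocyclic data under a functor. -/
def map (F : C ⥤ E) (D : CocyclicData C) : CocyclicData E where
  X n := F.obj (D.X n)
  δ n i := F.map (D.δ n i)
  σ n i := F.map (D.σ n i)
  τ n := F.map (D.τ n)

lemma IsCocyclic.map (F : C ⥤ E) {D : CocyclicData C} (h : D.IsCocyclic) :
    (D.map F).IsCocyclic where
  δ_δ n i j hij hj := by simpa [CocyclicData.map] using congrArg F.map (h.δ_δ n i j hij hj)
  σ_σ n i j hij hj := by simpa [CocyclicData.map] using congrArg F.map (h.σ_σ n i j hij hj)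
  δ_σ_lt n i j hij hj := by simpa [CocyclicData.map] using congrArg F.map (h.δ_σ_lt n i j hij hj)
  δ_σ_self n i hi := by simpa [CocyclicData.map] using congrArg F.map (h.δ_σ_self n i hi)
  δ_σ_succ n i hi := by simpa [CocyclicData.map] using congrArg F.map (h.δ_σ_succ n i hi)
  δ_σ_gt n i j hji hi := by simpa [CocyclicData.map] using congrArg F.map (h.δ_σ_gt n i j hji hi)
  δ_zero_τ n := by simpa [CocyclicData.map] using congrArg F.map (h.δ_zero_τ n)
  δ_succ_τ n i hi := by simpa [CocyclicData.map] using congrArg F.map (h.δ_succ_τ n i hi)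
  σ_zero_τ n := by simpa [CocyclicData.map] using congrArg F.map (h.σ_zero_τ n)
  σ_succ_τ n i hi := by simpa [CocyclicData.map] using congrArg F.map (h.σ_succ_τ n i hi)
  τ_pow n := by simpa [CocyclicData.map, map_iter] using congrArg F.map (h.τ_pow n)

end CocyclicData

end Map

section HopfOperators

variable {C : Type u} [Category.{v} C] [MonoidalCategory C] [SymmetricCategory C]
variable {H R : C} [MonObj R] [IsCommMonObj R]

lemma iterComul_tpowDesc [BimonObj H] : ∀ {n : ℕ} (a : Fin n → points H R),
    iterComul H n ≫ tpowDesc a = points.hom (Fin.partialProd a (Fin.last n))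
  | 0, _ => rfl
  | n + 1, a => by
    have ih := iterComul_tpowDesc (Fin.tail a)
    rw [← Fin.succ_last, Fin.partialProd_succ', points.hom_mul]
    refine (Category.assoc Δ[H] (H ◁ iterComul H n) _).trans (congrArg (Δ[H] ≫ ·) ?_)
    exact (whiskerLeft_copair _ _ _).trans (congrArg (copair _) ih)

lemma twistedAntipode_counit (H : C) [HopfObj H] : twistedAntipode H ε[H] = 𝒮[H] := by
  simp [twistedAntipode]

variable [HopfObj H] [IsCommMonObj H]

lemma coface_tpowDesc : ∀ (n i : ℕ) (a : Fin (n + 1) → points H R),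
    coface H η[H] η[H] n i ≫ tpowDesc a = tpowDesc (reindex (cofaceMap n i) a)
  | n, 0, a => by
    rw [cofaceMap_zero, reindex_succ]
    cases n <;> exact inr_copair _ _
  | 0, _ + 1, a => inr_copair _ _
  | n + 1, 1, a => by
    rw [cofaceMap_succ, reindex_cons_zero_succ_comp, cofaceMap_zero, reindex_succ,
      Fin.partialProd_succ, Fin.castSucc_zero, Fin.partialProd_zero, one_mul]
    refine (comul_whiskerRight_copair _ _ _).trans (congrArg (copair · _) ?_)
    exact (points.hom_mul _ _).symm
  | n + 1, i + 2, a => by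
    have h0 : cofaceMap n (i + 1) 0 = 0 := rfl
    rw [cofaceMap_succ, reindex_cons_zero_succ_comp, h0, Fin.partialProd_zero, mul_one]
    exact (whiskerLeft_copair _ _ _).trans
      (congrArg (copair _) (coface_tpowDesc n (i + 1) (Fin.tail a)))

lemma codegen_tpowDesc : ∀ (n i : ℕ) (a : Fin n → points H R),
    codegen H n i ≫ tpowDesc a = tpowDesc (reindex (codegenMap n i) a)
  | n, 0, a => by
    rw [codegenMap_zero, reindex_cons, reindex_id, id, inv_mul_cancel]
    cases n <;> exact (copair_counit_one _).symm
  | 0, i + 1, a => by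
    have h : codegenMap 0 (i + 1) = codegenMap 0 0 :=
      funext fun _ => Subsingleton.elim (α := Fin 1) _ _
    rw [h]
    exact codegen_tpowDesc 0 0 a
  | n + 1, i + 1, a => by
    have h0 : codegenMap n i 0 = 0 := by simp [codegenMap]
    rw [codegenMap_succ, reindex_cons_zero_succ_comp, h0, Fin.partialProd_zero, mul_one]
    exact (whiskerLeft_copair _ _ _).trans
      (congrArg (copair _) (codegen_tpowDesc n i (Fin.tail a)))

lemma cyclicOp_tpowDesc (n : ℕ) (a : Fin n → points H R) :
    cyclicOp H ε[H] η[H] n ≫ tpowDesc a = tpowDesc (reindex (rotationMap n) a) := by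
  cases n with
  | zero => exact Category.id_comp _
  | succ n =>
    have hS : (twistedAntipode H ε[H] ≫ iterComul H (n + 1)) ≫ tpowDesc a =
        points.hom (Fin.partialProd a (Fin.last (n + 1)))⁻¹ := by
      rw [twistedAntipode_counit, Category.assoc, iterComul_tpowDesc, points.hom_inv]
    have hδ := coface_tpowDesc n (n + 1) a
    rw [rotationMap, reindex_cons, reindex_castSucc, Fin.castSucc_zero, Fin.partialProd_zero,
      mul_one]
    rw [cofaceMap_last, reindex_castSucc] at hδ
    rw [cyclicOp, mulPow_eq_mul]
    exact (copair_comp _ _ (tpowDesc a)).trans (congrArg₂ copair hS hδ)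

end HopfOperators

section VertexFunctor

variable {C : Type u} [Category.{v} C] [MonoidalCategory C] [SymmetricCategory C]
variable (H : C) [HopfObj H] [IsCommMonObj H]

/-- The functor `{0, …, n} ↦ H^n` on the category of nonempty finite sets. If `H` is the coordinate
ring of an affine group scheme `G`, it is the coordinate ring of `Map({0, …, n}, G) / G`. -/
def vertexFunctor : VertexCat ⥤ C where
  obj n := tpow H n.dim
  map {_ n} f := tpowDesc (reindex f (tautPoint H n.dim))
  map_id n := (congrArg tpowDesc (reindex_id _)).trans (tpowDesc_tautPoint n.dim)
  map_comp {_ m n} f g := by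
    rw [tpowDesc_comp, map_comp_reindex, map_tpowDesc_tautPoint, reindex_reindex]
    rfl

lemma cocyclic_map_vertexFunctor :
    VertexCat.cocyclic.map (vertexFunctor H) = hopfCocyclicData H ε[H] η[H] := by
  have eq_map {m n : ℕ} {φ : tpow H m ⟶ tpow H n} {f : Fin (m + 1) → Fin (n + 1)}
      (h : φ ≫ tpowDesc (tautPoint H n) = tpowDesc (reindex f (tautPoint H n))) :
      tpowDesc (reindex f (tautPoint H n)) = φ := by
    rw [← h, tpowDesc_tautPoint, Category.comp_id]
  refine (CocyclicData.mk.injEq ..).mpr ⟨rfl, heq_of_eq ?_, heq_of_eq ?_, heq_of_eq ?_⟩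
  · exact funext₂ fun n i => eq_map (coface_tpowDesc n i _)
  · exact funext₂ fun n i => eq_map (codegen_tpowDesc n i _)
  · exact funext fun n => eq_map (cyclicOp_tpowDesc n _)

lemma isCocyclic_hopfCocyclicData : (hopfCocyclicData H ε[H] η[H]).IsCocyclic :=
  cocyclic_map_vertexFunctor H ▸ VertexCat.isCocyclic_cocyclic.map (vertexFunctor H)

lemma isModularPairInInvolution : IsModularPairInInvolution H ε[H] η[H] where
  character := ⟨by rw [BimonObj.mul_counit]; rfl, BimonObj.one_counit H⟩
  cocharacter := isCocharacter_one H
  modular := BimonObj.one_counit H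
  involution := by
    rw [twistedAntipode_counit, HopfObj.antipode_antipode H (IsCommMonObj.mul_comm H),
      HopfObj.one_antipode, ← tensorHom_id, ← tensorHom_id, tensorHom_comp_tensorHom_assoc,
      tensorHom_comp_tensorHom_assoc, Category.assoc, MonObj.one_mul_hom,
      Iso.inv_hom_id_assoc, Category.comp_id, Category.id_comp, MonObj.mul_one_hom]
    simp

end VertexFunctor

/-! ### Sections of the projection to column zero -/

section ColumnZeroSection

variable {C : Type u} [Category.{v} C] [Preadditive C] {E : Type u'} [Category.{v'} E]
  [Preadditive E]

namespace CocyclicData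

/-- The identity of `X q` as a morphism `X p ⟶ X q` if `p = q`, and zero otherwise. -/
def kronecker (D : CocyclicData C) (p q : ℕ) : D.X p ⟶ D.X q :=
  if h : p = q then eqToHom (by rw [h]) else 0

@[simp]
lemma kronecker_self (D : CocyclicData C) (q : ℕ) : D.kronecker q q = 𝟙 _ := by simp [kronecker]

lemma kronecker_of_ne (D : CocyclicData C) {p q : ℕ} (h : p ≠ q) : D.kronecker p q = 0 := by
  simp [kronecker, h]

/-- The component in row `q` of the total differential of the cyclic bicomplex, applied to the
family of morphisms `x q : A ⟶ X q` into its entries `(n - q, q)` of total degree `n`. -/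
def totalD (D : CocyclicData C) {A : C} (n : ℕ) (x : ∀ q, A ⟶ D.X q) : ∀ q, A ⟶ D.X q
  | 0 => x 0 ≫ D.horiz n 0
  | q + 1 => x (q + 1) ≫ D.horiz (n - (q + 1)) (q + 1) +
      (-1 : ℤ) ^ (n - q) • (x q ≫ D.vert (n - q) q)

/-- A family `ρ n q : X n ⟶ X q` which, when `X q` is placed in column `n - q` of the cyclic
bicomplex, is a morphism of complexes from column zero to the total complex, and the identity in
column zero. -/
structure IsColumnZeroSection (D : CocyclicData C) (ρ : ∀ n q, D.X n ⟶ D.X q) : Prop where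
  self : ∀ n, ρ n n = 𝟙 (D.X n)
  eq_zero : ∀ n q, n < q → ρ n q = 0
  b_comp : ∀ n q, D.b n ≫ ρ (n + 1) q = D.totalD n (ρ n) q

lemma comp_totalD (D : CocyclicData C) {A B : C} (f : B ⟶ A) (n : ℕ) (x : ∀ q, A ⟶ D.X q)
    (q : ℕ) : f ≫ D.totalD n x q = D.totalD n (fun q => f ≫ x q) q := by
  cases q <;> simp [totalD]

lemma totalD_of_lt (D : CocyclicData C) {A : C} {n : ℕ} {x : ∀ q, A ⟶ D.X q}
    (hx : ∀ q, n < q → x q = 0) {q : ℕ} (hq : n + 1 < q) : D.totalD n x q = 0 := by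
  obtain ⟨q, rfl⟩ := Nat.exists_eq_add_of_lt hq
  rw [totalD, hx _ (by omega), hx _ (by omega), zero_comp, zero_comp, smul_zero, add_zero]

lemma totalD_last (D : CocyclicData C) {A : C} {n : ℕ} {x : ∀ q, A ⟶ D.X q}
    (hx : ∀ q, n < q → x q = 0) : D.totalD n x (n + 1) = x n ≫ D.b n := by
  simp [totalD, hx, vert]

lemma IsCocyclic.totalD_totalD {D : CocyclicData C} (h : D.IsCocyclic) {A : C} (n : ℕ)
    (x : ∀ q, A ⟶ D.X q) (hx : ∀ q, n < q → x q = 0) {q : ℕ} (hq : q ≤ n + 1) :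
    D.totalD (n + 1) (D.totalD n x) q = 0 := by
  have horiz_horiz (q : ℕ) (hq : q ≤ n + 1) :
      x q ≫ D.horiz (n - q) q ≫ D.horiz (n + 1 - q) q = 0 := by
    by_cases hqn : q ≤ n
    · rw [show n + 1 - q = n - q + 1 by omega, h.horiz_horiz, comp_zero]
    · rw [hx q (by omega), zero_comp]
  match q with
  | 0 => simpa [totalD] using horiz_horiz 0 hq
  | 1 =>
    have hh := horiz_horiz 1 hq
    have hhv := h.horiz_vert n 0
    rw [show n + 1 - 1 = n by omega] at hh
    simp only [totalD, Nat.sub_zero, zero_add, Nat.add_sub_cancel, Preadditive.add_comp,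
      Category.assoc, hh, Preadditive.zsmul_comp, hhv, pow_succ]
    simp
  | q + 2 =>
    have hh := horiz_horiz (q + 2) hq
    have hhv := h.horiz_vert (n - (q + 1)) (q + 1)
    rw [show n + 1 - (q + 2) = n - (q + 1) by omega] at hh
    simp only [totalD, Preadditive.add_comp, Category.assoc, hh, Preadditive.zsmul_comp,
      show n + 1 - (q + 2) = n - (q + 1) by omega,
      show n + 1 - (q + 1) = n - (q + 1) + 1 by omega, hhv,
      show n - q = n - (q + 1) + 1 by omega, h.vert_vert, pow_succ]
    simp

section Map

variable (F : C ⥤ E) [F.Additive] (D : CocyclicData C)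

lemma map_altSum {A B : C} (k : ℕ) (f : ℕ → (A ⟶ B)) :
    F.map (altSum k f) = altSum k fun i => F.map (f i) := by
  simp [altSum, Functor.map_sum]

lemma map_b (n : ℕ) : F.map (D.b n) = (D.map F).b n := map_altSum F _ _

lemma map_b' (n : ℕ) : F.map (D.b' n) = (D.map F).b' n := map_altSum F _ _

lemma map_t (n : ℕ) : F.map (D.t n) = (D.map F).t n := F.map_zsmul

lemma map_N (n : ℕ) : F.map (D.N n) = (D.map F).N n := by
  simp only [N, Functor.map_sum, map_iter, map_t]
  rfl

lemma map_vert (p q : ℕ) : F.map (D.vert p q) = (D.map F).vert p q := by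
  unfold vert
  split_ifs
  exacts [D.map_b F q, D.map_b' F q]

lemma map_horiz (p q : ℕ) : F.map (D.horiz p q) = (D.map F).horiz p q := by
  unfold horiz
  split_ifs
  · rw [F.map_sub, F.map_id, map_t]
    rfl
  · exact D.map_N F q

lemma map_totalD {A : C} (n : ℕ) (x : ∀ q, A ⟶ D.X q) (q : ℕ) :
    F.map (D.totalD n x q) = (D.map F).totalD n (fun q => F.map (x q)) q := by
  cases q <;> simp only [totalD, F.map_add, F.map_zsmul, F.map_comp, map_horiz, map_vert] <;> rfl

lemma IsColumnZeroSection.map {D : CocyclicData C} {ρ : ∀ n q, D.X n ⟶ D.X q}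
    (hρ : D.IsColumnZeroSection ρ) : (D.map F).IsColumnZeroSection fun n q => F.map (ρ n q) where
  self n := (congrArg F.map (hρ.self n)).trans (F.map_id _)
  eq_zero n q hq := (congrArg F.map (hρ.eq_zero n q hq)).trans (F.map_zero _ _)
  b_comp n q := by
    rw [← map_b]
    exact (F.map_comp _ _).symm.trans
      ((congrArg F.map (hρ.b_comp n q)).trans (map_totalD F D n (ρ n) q))

end Map

/-- Additive operators `cone : Hom(X m, X n) → Hom(X (m + 1), X n)` which, like the formation of
cones over simplices, have the original simplex as their zeroth face, and as their other faces the
cones over its faces. -/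
structure ConeOperator (D : CocyclicData C) where
  /-- The cone over a morphism. -/
  cone : ∀ {m n : ℕ}, (D.X m ⟶ D.X n) →+ (D.X (m + 1) ⟶ D.X n)
  δ_zero_cone : ∀ {m n : ℕ} (x : D.X m ⟶ D.X n), D.δ m 0 ≫ cone x = x
  δ_succ_cone : ∀ {m n : ℕ} (i : ℕ) (x : D.X (m + 1) ⟶ D.X n),
    D.δ (m + 1) (i + 1) ≫ cone x = cone (D.δ m i ≫ x)

namespace ConeOperator

variable {D : CocyclicData C} (c : D.ConeOperator)

lemma b_comp_cone {m n : ℕ} (x : D.X (m + 1) ⟶ D.X n) :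
    D.b (m + 1) ≫ c.cone x = x - c.cone (D.b m ≫ x) := by
  have h (i : ℕ) : ((-1 : ℤ) ^ (i + 1) • D.δ (m + 1) (i + 1)) ≫ c.cone x =
      -c.cone (((-1 : ℤ) ^ i • D.δ m i) ≫ x) := by
    rw [Preadditive.zsmul_comp, c.δ_succ_cone, Preadditive.zsmul_comp, map_zsmul, pow_succ,
      mul_neg_one, neg_smul]
  rw [b, altSum, Finset.sum_range_succ', Preadditive.add_comp, b, altSum, Preadditive.sum_comp,
    Preadditive.sum_comp, map_sum, pow_zero, one_smul, c.δ_zero_cone,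
    Finset.sum_congr rfl fun i _ => h i, Finset.sum_neg_distrib, neg_add_eq_sub]

/-- The section of the projection to column zero that is constructed by coning. -/
def columnSection : ∀ n q : ℕ, D.X n ⟶ D.X q
  | 0, q => D.kronecker 0 q
  | n + 1, q =>
    if q ≤ n then c.cone (D.totalD n (columnSection n) q) else D.kronecker (n + 1) q

lemma columnSection_self (n : ℕ) : c.columnSection n n = 𝟙 _ := by
  cases n <;> simp [columnSection]

lemma columnSection_of_lt {n q : ℕ} (h : n < q) : c.columnSection n q = 0 := by
  cases n with
  | zero => exact D.kronecker_of_ne h.ne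
  | succ n => rw [columnSection, if_neg (by omega), D.kronecker_of_ne h.ne]

lemma columnSection_of_le {n q : ℕ} (h : q ≤ n) :
    c.columnSection (n + 1) q = c.cone (D.totalD n (c.columnSection n) q) := if_pos h

lemma b_comp_columnSection (hD : D.IsCocyclic) (n q : ℕ) :
    D.b n ≫ c.columnSection (n + 1) q = D.totalD n (c.columnSection n) q := by
  rcases Nat.lt_trichotomy q (n + 1) with hq | rfl | hq
  · rw [Nat.lt_succ_iff] at hq
    rw [c.columnSection_of_le hq]
    cases n with
    | zero =>
      have h_horiz : D.horiz 0 0 = 0 := by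
        simpa [horiz, iter, sub_eq_zero] using (hD.t_pow 0).symm
      obtain rfl : q = 0 := by omega
      rw [totalD, h_horiz, comp_zero, map_zero, comp_zero]
    | succ n =>
      rw [b_comp_cone, comp_totalD, funext (b_comp_columnSection hD n),
        hD.totalD_totalD n _ (fun _ => c.columnSection_of_lt) hq, map_zero, sub_zero]
  · rw [c.columnSection_self, Category.comp_id, D.totalD_last fun _ => c.columnSection_of_lt,
      c.columnSection_self, Category.id_comp]
  · rw [c.columnSection_of_lt hq, comp_zero, D.totalD_of_lt (fun _ => c.columnSection_of_lt) hq]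

lemma isColumnZeroSection (hD : D.IsCocyclic) : D.IsColumnZeroSection c.columnSection where
  self := c.columnSection_self
  eq_zero _ _ := c.columnSection_of_lt
  b_comp := c.b_comp_columnSection hD

end ConeOperator

end CocyclicData

end ColumnZeroSection

/-! ### Coning in the linear completion of the vertex category -/

section AcyclicModels

namespace VertexCat

/-- The cone, with apex `0`, over a singular simplex of `{0, …, n}`. -/
def cone {m n : ℕ} (f : of m ⟶ of n) : of (m + 1) ⟶ of n :=
  fun k => Fin.cases 0 f k

lemma δ_zero_cone {m n : ℕ} (f : of m ⟶ of n) : cofaceMap m 0 ≫ cone f = f := by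
  funext k
  have h : cofaceMap m 0 k = k.succ := Fin.ext ((val_cofaceMap m 0 k).trans (by simp))
  rw [comp_apply, h]
  rfl

lemma δ_succ_cone {m n : ℕ} (i : ℕ) (f : of (m + 1) ⟶ of n) :
    cofaceMap (m + 1) (i + 1) ≫ cone f = cone (cofaceMap m i ≫ f) := by
  funext k
  refine Fin.cases ?_ (fun k => ?_) k
  · have h : cofaceMap (m + 1) (i + 1) 0 = 0 := Fin.ext ((val_cofaceMap _ _ _).trans (by simp))
    rw [comp_apply, h]
    rfl
  · have h : cofaceMap (m + 1) (i + 1) k.succ = (cofaceMap m i k).succ := by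
      ext
      rw [val_cofaceMap, Fin.val_succ, Fin.val_succ, val_cofaceMap]
      grind
    rw [comp_apply, h]
    rfl

attribute [local instance] uliftCategory

/-- The functor from `VertexCat` to its `ℤ`-linear completion, after lifting `VertexCat` to the
universes in which the universal property of the completion is available. -/
def toFree : VertexCat ⥤ Free ℤ (ULiftHom.{v} (ULift.{u} VertexCat)) :=
  ULift.upFunctor ⋙ ULiftHom.up ⋙ Free.embedding ℤ _

lemma toFree_addHom_ext {m n : VertexCat} {A : Type*} [AddMonoid A]
    {φ ψ : (toFree.{v, u}.obj m ⟶ toFree.obj n) →+ A}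
    (h : ∀ f : m ⟶ n, φ (toFree.map f) = ψ (toFree.map f)) : φ = ψ :=
  Finsupp.addHom_ext' fun f => AddMonoidHom.ext_int (h f.down)

/-- The additive extension of the formation of cones to linear combinations of simplices. -/
def coneHom (m n : ℕ) : (toFree.{v, u}.obj (of m) ⟶ toFree.obj (of n)) →+
    (toFree.{v, u}.obj (of (m + 1)) ⟶ toFree.obj (of n)) :=
  Finsupp.mapDomain.addMonoidHom
    (fun f => ULift.up (cone f.down) : ULift (of m ⟶ of n) → ULift (of (m + 1) ⟶ of n))

lemma coneHom_toFree_map {m n : ℕ} (f : of m ⟶ of n) :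
    coneHom m n (toFree.{v, u}.map f) = toFree.map (cone f) := Finsupp.mapDomain_single

/-- Coning operates on the `ℤ`-linear completion of `VertexCat`. -/
def coneOperator : (cocyclic.map toFree.{v, u}).ConeOperator where
  cone {m n} := coneHom.{v, u} m n
  δ_zero_cone {m n} x := by
    refine DFunLike.congr_fun (toFree_addHom_ext (φ := (Preadditive.leftComp _
      (toFree.map (cofaceMap m 0))).comp (coneHom m n)) (ψ := .id _) fun f => ?_) x
    change toFree.map _ ≫ coneHom m n (toFree.map f) = toFree.map f
    rw [coneHom_toFree_map, ← toFree.map_comp, δ_zero_cone]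
  δ_succ_cone {m n} i x := by
    refine DFunLike.congr_fun (toFree_addHom_ext (φ := (Preadditive.leftComp _
      (toFree.map (cofaceMap (m + 1) (i + 1)))).comp (coneHom (m + 1) n))
      (ψ := (coneHom m n).comp (Preadditive.leftComp _ (toFree.map (cofaceMap m i)))) fun f => ?_) x
    change toFree.map _ ≫ coneHom (m + 1) n (toFree.map f) = coneHom m n (_ ≫ toFree.map f)
    rw [coneHom_toFree_map, ← toFree.map_comp, ← toFree.map_comp, coneHom_toFree_map, δ_succ_cone]

variable {C : Type u} [Category.{v} C] [Preadditive C]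

/-- The additive extension of a functor to the `ℤ`-linear completion of `VertexCat`. -/
def freeLift (F : VertexCat ⥤ C) : Free ℤ (ULiftHom.{v} (ULift.{u} VertexCat)) ⥤ C :=
  Free.lift ℤ (ULiftHom.down ⋙ ULift.downFunctor ⋙ F)

instance (F : VertexCat ⥤ C) : (freeLift F).Additive :=
  inferInstanceAs (Free.lift ℤ _).Additive

lemma freeLift_map_toFree_map (F : VertexCat ⥤ C) {m n : VertexCat} (f : m ⟶ n) :
    (freeLift F).map (toFree.map f) = F.map f :=
  (Free.lift_map_single ℤ (ULiftHom.down ⋙ ULift.downFunctor ⋙ F) _ _).trans (one_smul _ _)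

lemma map_toFree_map_freeLift (F : VertexCat ⥤ C) (D : CocyclicData VertexCat) :
    (D.map toFree).map (freeLift F) = D.map F := by
  refine CocyclicData.mk.injEq .. |>.mpr ⟨rfl, ?_, ?_, ?_⟩ <;> refine heq_of_eq ?_
  exacts [funext₂ fun _ _ => freeLift_map_toFree_map F _,
    funext₂ fun _ _ => freeLift_map_toFree_map F _, funext fun _ => freeLift_map_toFree_map F _]

lemma exists_isColumnZeroSection (F : VertexCat ⥤ C) :
    ∃ ρ, (cocyclic.map F).IsColumnZeroSection ρ := by
  rw [← map_toFree_map_freeLift]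
  exact ⟨_, (coneOperator.isColumnZeroSection (isCocyclic_cocyclic.map toFree)).map (freeLift F)⟩

end VertexCat

end AcyclicModels

/-! ### The total complex -/

section TotalComplex

namespace CocyclicData.IsCocyclic

variable {C : Type u} [Category.{v} C] [Abelian C] {D : CocyclicData C} (h : D.IsCocyclic)

/-- The complex `(X, b)`, which is column zero of the cyclic bicomplex. -/
def hochschild : CochainComplex C ℕ := CochainComplex.of D.X D.b h.b_b

lemma hochschild_d (n : ℕ) : h.hochschild.d n (n + 1) = D.b n := CochainComplex.of_d _ _ _

/-- The total complex of the cyclic bicomplex. -/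
def tot : CochainComplex C ℕ := h.cyclicBicomplex.total (ComplexShape.up ℕ)

/-- The inclusion into the total complex in degree `n` of the entry in row `q`, that is, in column
`n - q`; it is zero for `q > n`. -/
def inc (n q : ℕ) : D.X q ⟶ h.tot.X n :=
  if hq : q ≤ n then
    h.cyclicBicomplex.ιTotal (ComplexShape.up ℕ) (n - q) q n
      (show n - q + q = n from Nat.sub_add_cancel hq)
  else 0

lemma inc_eq {n q p : ℕ} (hpq : p + q = n) :
    h.inc n q = h.cyclicBicomplex.ιTotal (ComplexShape.up ℕ) p q n hpq := by
  obtain rfl : p = n - q := by omega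
  exact dif_pos (by omega)

variable {h} in
lemma hom_ext_inc {n : ℕ} {A : C} {f g : h.tot.X n ⟶ A}
    (hfg : ∀ q ≤ n, h.inc n q ≫ f = h.inc n q ≫ g) : f = g := by
  refine HomologicalComplex₂.total.hom_ext (ComplexShape.up ℕ) fun p q (hpq : p + q = n) => ?_
  rw [← h.inc_eq hpq]
  exact hfg q (by omega)

lemma inc_d {n q : ℕ} (hq : q ≤ n) : h.inc n q ≫ h.tot.d n (n + 1) =
    D.horiz (n - q) q ≫ h.inc (n + 1) q +
      (-1 : ℤ) ^ (n - q) • (D.vert (n - q) q ≫ h.inc (n + 1) (q + 1)) := by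
  obtain ⟨p, rfl⟩ := Nat.exists_eq_add_of_le' hq
  have h_horiz : (h.cyclicBicomplex.d p (p + 1)).f q = D.horiz p q :=
    congrArg (fun φ : h.column p ⟶ h.column (p + 1) => φ.f q) (CochainComplex.of_d h.column _ p)
  have h_vert : (h.cyclicBicomplex.X p).d q (q + 1) = D.vert p q := CochainComplex.of_d _ _ _
  rw [Nat.add_sub_cancel, h.inc_eq (p := p) rfl, h.inc_eq (p := p + 1) (q := q) (by omega),
    h.inc_eq (p := p) (q := q + 1) (by omega)]
  refine (Preadditive.comp_add _ _ _ _ _ _).trans (congrArg₂ (· + ·) ?_ ?_)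
  · refine (h.cyclicBicomplex.ι_D₁ _ _ _ _ _ _).trans <|
      (h.cyclicBicomplex.d₁_eq (ComplexShape.up ℕ) (i₁ := p) (i₁' := p + 1) rfl q (p + q + 1)
        (show p + 1 + q = p + q + 1 by omega)).trans ?_
    rw [h_horiz]
    exact one_smul _ _
  · refine (h.cyclicBicomplex.ι_D₂ _ _ _ _ _ _).trans <|
      (h.cyclicBicomplex.d₂_eq (ComplexShape.up ℕ) p (i₂ := q) (i₂' := q + 1) rfl (p + q + 1)
        (show p + (q + 1) = p + q + 1 by omega)).trans ?_
    rw [h_vert]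
    change ((-1 : ℤˣ) ^ p) • _ = _
    rw [Units.smul_def, Units.val_pow_eq_pow_val, Units.val_neg, Units.val_one]
    rfl

/-- The projection of the total complex in degree `n` to the entry in row `q`, that is, in column
`n - q`; it is zero for `q > n`. -/
def proj (n q : ℕ) : h.tot.X n ⟶ D.X q :=
  h.cyclicBicomplex.totalDesc fun _ r _ => D.kronecker r q

lemma inc_proj {n r : ℕ} (hr : r ≤ n) (q : ℕ) : h.inc n r ≫ h.proj n q = D.kronecker r q := by
  rw [h.inc_eq (Nat.sub_add_cancel hr)]
  exact h.cyclicBicomplex.ι_totalDesc _ _ _ _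

lemma proj_eq_zero {n q : ℕ} (hq : n < q) : h.proj n q = 0 :=
  hom_ext_inc fun r hr => by rw [h.inc_proj hr, D.kronecker_of_ne (by omega), comp_zero]

/-- The morphism into the total complex in degree `n` with components `x q : A ⟶ X q`, `q ≤ n`. -/
def lift {A : C} (n : ℕ) (x : ∀ q, A ⟶ D.X q) : A ⟶ h.tot.X n :=
  ∑ q ∈ Finset.range (n + 1), x q ≫ h.inc n q

lemma lift_proj {A : C} {n q : ℕ} (hq : q ≤ n) (x : ∀ q, A ⟶ D.X q) :
    h.lift n x ≫ h.proj n q = x q := by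
  rw [lift, Preadditive.sum_comp, Finset.sum_eq_single_of_mem q (Finset.mem_range_succ_iff.2 hq),
    Category.assoc, h.inc_proj hq, D.kronecker_self, Category.comp_id]
  intro r hr hrq
  rw [Category.assoc, h.inc_proj (Finset.mem_range_succ_iff.1 hr), D.kronecker_of_ne hrq, comp_zero]

lemma lift_proj_of_eq_zero {A : C} {n : ℕ} {x : ∀ q, A ⟶ D.X q} (hx : ∀ q, n < q → x q = 0)
    (q : ℕ) : h.lift n x ≫ h.proj n q = x q := by
  rcases le_or_gt q n with hq | hq
  · exact h.lift_proj hq x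
  · rw [h.proj_eq_zero hq, hx q hq, comp_zero]

lemma inc_lift_proj {n q : ℕ} (hq : q ≤ n) : h.inc n q ≫ h.lift n (h.proj n) = h.inc n q := by
  rw [lift, Preadditive.comp_sum, Finset.sum_eq_single_of_mem q (Finset.mem_range_succ_iff.2 hq),
    ← Category.assoc, h.inc_proj hq, D.kronecker_self, Category.id_comp]
  intro r _ hrq
  rw [← Category.assoc, h.inc_proj hq, D.kronecker_of_ne hrq.symm, zero_comp]

lemma lift_proj_self (n : ℕ) : h.lift n (h.proj n) = 𝟙 _ :=
  hom_ext_inc fun _ hq => (h.inc_lift_proj hq).trans (Category.comp_id _).symm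

variable {h} in
lemma hom_ext_proj {n : ℕ} {A : C} {f g : A ⟶ h.tot.X n}
    (hfg : ∀ q ≤ n, f ≫ h.proj n q = g ≫ h.proj n q) : f = g := by
  rw [← Category.comp_id f, ← Category.comp_id g, ← h.lift_proj_self, lift, Preadditive.comp_sum,
    Preadditive.comp_sum]
  refine Finset.sum_congr rfl fun q hq => ?_
  rw [← Category.assoc, ← Category.assoc, hfg q (Finset.mem_range_succ_iff.1 hq)]

lemma d_proj (n q : ℕ) : h.tot.d n (n + 1) ≫ h.proj (n + 1) q = D.totalD n (h.proj n) q := by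
  refine hom_ext_inc fun r hr => ?_
  rw [comp_totalD, ← Category.assoc, h.inc_d hr, Preadditive.add_comp, Category.assoc,
    h.inc_proj (by omega), Preadditive.zsmul_comp, Category.assoc, h.inc_proj (by omega),
    funext (h.inc_proj hr)]
  cases q with
  | zero =>
    rw [D.kronecker_of_ne r.succ_ne_zero, comp_zero, smul_zero, add_zero, totalD]
    rcases eq_or_ne r 0 with rfl | hr0
    · simp
    · simp [D.kronecker_of_ne hr0]
  | succ q =>
    refine congrArg₂ (· + ·) ?_ ?_
    · rcases eq_or_ne r (q + 1) with rfl | hrq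
      · simp
      · simp [D.kronecker_of_ne hrq]
    · rcases eq_or_ne r q with rfl | hrq
      · simp
      · simp [D.kronecker_of_ne hrq, D.kronecker_of_ne (Nat.succ_ne_succ_iff.2 hrq)]

lemma lift_d {A : C} {n : ℕ} {x : ∀ q, A ⟶ D.X q} (hx : ∀ q, n < q → x q = 0) :
    h.lift n x ≫ h.tot.d n (n + 1) = h.lift (n + 1) (D.totalD n x) :=
  hom_ext_proj fun q hq => by
    rw [Category.assoc, d_proj, comp_totalD, h.lift_proj hq, funext (h.lift_proj_of_eq_zero hx)]

/-- The projection of the total complex to column zero. -/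
def toColumnZero : h.tot ⟶ h.hochschild where
  f n := h.proj n n
  comm' n m hnm := by
    obtain rfl : n + 1 = m := hnm
    rw [hochschild_d]
    exact (D.totalD_last fun _ => h.proj_eq_zero).symm.trans (h.d_proj n (n + 1)).symm

variable {h} {ρ : ∀ n q, D.X n ⟶ D.X q}

/-- The morphism of complexes with components `ρ`. -/
def ofColumnZero (hρ : D.IsColumnZeroSection ρ) : h.hochschild ⟶ h.tot where
  f n := h.lift n (ρ n)
  comm' n m hnm := by
    obtain rfl : n + 1 = m := hnm
    rw [hochschild_d]
    refine (h.lift_d (hρ.eq_zero n)).trans (hom_ext_proj fun q hq => ?_)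
    rw [h.lift_proj hq, ← hρ.b_comp]
    exact ((Category.assoc _ _ _).trans (congrArg _ (h.lift_proj hq _))).symm

lemma ofColumnZero_toColumnZero (hρ : D.IsColumnZeroSection ρ) :
    ofColumnZero hρ ≫ h.toColumnZero = 𝟙 _ := by
  ext n
  exact (h.lift_proj le_rfl _).trans (hρ.self n)

end CocyclicData.IsCocyclic

end TotalComplex

section ShiftTwo

variable {C : Type u} [Category.{v} C] [HasZeroMorphisms C] [HasZeroObject C]
  (K : CochainComplex C ℕ)

/-- The complex `K` shifted up by two degrees, which is zero in degrees `0` and `1`. -/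
def shiftTwo : CochainComplex C ℕ := K.extend (ComplexShape.embeddingUp'Add 1 2)

/-- The identification of `shiftTwo K` in degree `n + 2` with `K` in degree `n`. -/
def shiftTwoXIso (n : ℕ) : (shiftTwo K).X (n + 2) ≅ K.X n :=
  K.extendXIso (ComplexShape.embeddingUp'Add 1 2) rfl

lemma isZero_shiftTwo_X {n : ℕ} (hn : n < 2) : IsZero ((shiftTwo K).X n) :=
  K.isZero_extend_X _ n fun _ => (hn.trans_le (Nat.le_add_left 2 _)).ne'

lemma shiftTwo_d (n : ℕ) : (shiftTwo K).d (n + 2) (n + 3) =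
    (shiftTwoXIso K n).hom ≫ K.d n (n + 1) ≫ (shiftTwoXIso K (n + 1)).inv :=
  K.extend_d_eq (ComplexShape.embeddingUp'Add 1 2) rfl rfl

/-- The homology of `shiftTwo K` in degree `n + 2` is that of `K` in degree `n`. -/
def shiftTwoHomologyIso [CategoryWithHomology C] (n : ℕ) :
    (shiftTwo K).homology (n + 2) ≅ K.homology n :=
  K.extendHomologyIso (ComplexShape.embeddingUp'Add 1 2) rfl

lemma isZero_shiftTwo_homology [CategoryWithHomology C] {n : ℕ} (hn : n < 2) :
    IsZero ((shiftTwo K).homology n) :=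
  ((shiftTwo K).exactAt_iff_isZero_homology n).1
    (K.extend_exactAt _ n fun _ => (hn.trans_le (Nat.le_add_left 2 _)).ne')

variable {K} {L : CochainComplex C ℕ}

/-- The morphism from `shiftTwo K` given by morphisms that raise degrees by two. -/
def ofShiftTwo (f : ∀ n, K.X n ⟶ L.X (n + 2))
    (hf : ∀ n, f n ≫ L.d (n + 2) (n + 3) = K.d n (n + 1) ≫ f (n + 1)) : shiftTwo K ⟶ L where
  f
    | n + 2 => (shiftTwoXIso K n).hom ≫ f n
    | _ => 0
  comm' n m hnm := by
    obtain rfl : n + 1 = m := hnm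
    match n with
    | 0 => exact (isZero_shiftTwo_X K Nat.zero_lt_two).eq_of_src _ _
    | 1 => exact (isZero_shiftTwo_X K Nat.one_lt_two).eq_of_src _ _
    | n + 2 =>
      rw [shiftTwo_d]
      simp [hf]

end ShiftTwo

/-! ### Splitting by periodicity -/

section Splitting

variable {C : Type u} [Category.{v} C]

lemma exists_comp_eq_of_degreewise [HasZeroMorphisms C] {J : Type*} {c : ComplexShape J}
    {A S T : HomologicalComplex C c} (i : S ⟶ T) [∀ n, Mono (i.f n)] (φ : A ⟶ T)
    (hφ : ∀ n, ∃ ψ : A.X n ⟶ S.X n, ψ ≫ i.f n = φ.f n) : ∃ ψ : A ⟶ S, ψ ≫ i = φ := by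
  choose ψ hψ using hφ
  refine ⟨⟨ψ, fun m n _ => ?_⟩, HomologicalComplex.hom_ext _ _ hψ⟩
  rw [← cancel_mono (i.f n), Category.assoc, ← i.comm, reassoc_of% hψ, φ.comm, Category.assoc, hψ]

open HomologicalComplex in
lemma nonempty_homology_iso_biprod [Preadditive C] [CategoryWithHomology C]
    [HasBinaryBiproducts C] {J : Type*} {c : ComplexShape J}
    {K T S : HomologicalComplex C c} {π : T ⟶ K} {ρ : K ⟶ T} (hρπ : ρ ≫ π = 𝟙 K)
    {i : S ⟶ T} [Mono i] (hiπ : i ≫ π = 0) {ν : T ⟶ T} (hν : Homotopy ν 0) (hiν : i ≫ ν = 0)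
    {ψ : T ⟶ S} (hψi : ψ ≫ i = (𝟙 T - π ≫ ρ) ≫ (𝟙 T - ν)) (n : J) :
    Nonempty (T.homology n ≅ K.homology n ⊞ S.homology n) := by
  have hiψ : i ≫ ψ = 𝟙 S := by
    rw [← cancel_mono i, Category.assoc, hψi, Preadditive.sub_comp, Preadditive.comp_sub,
      Category.id_comp, Category.id_comp, Preadditive.comp_sub, hiν, Category.comp_id, sub_zero,
      Category.assoc, reassoc_of% hiπ, zero_comp, sub_zero]
  have hρψ : ρ ≫ ψ = 0 := by
    rw [← cancel_mono i, Category.assoc, hψi, Preadditive.sub_comp, Preadditive.comp_sub,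
      Category.id_comp, Category.assoc, reassoc_of% hρπ, sub_self, zero_comp]
  have total : homologyMap π n ≫ homologyMap ρ n + homologyMap ψ n ≫ homologyMap i n = 𝟙 _ := by
    rw [← homologyMap_comp ψ, hψi, homologyMap_comp, homologyMap_sub, homologyMap_sub,
      hν.homologyMap_eq, homologyMap_zero, homologyMap_id, sub_zero, Category.comp_id,
      homologyMap_comp, add_sub_cancel]
  refine ⟨⟨biprod.lift (homologyMap π n) (homologyMap ψ n),
    biprod.desc (homologyMap ρ n) (homologyMap i n), ?_, ?_⟩⟩
  · rw [biprod.lift_desc, total]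
  · apply biprod.hom_ext' <;> apply biprod.hom_ext
    all_goals simp [← homologyMap_comp, hρπ, hiπ, hiψ, hρψ]

lemma nullHomotopicMap'_zero [Preadditive C] {J : Type*} {c : ComplexShape J}
    {K L : HomologicalComplex C c} :
    Homotopy.nullHomotopicMap' (fun i j _ => (0 : K.X i ⟶ L.X j)) = 0 := by
  simpa using (Homotopy.nullHomotopicMap'_comp (fun i j _ => (0 : K.X i ⟶ L.X j)) (0 : L ⟶ L)).symm

end Splitting

section Periodicity

namespace CocyclicData

variable {C : Type u} [Category.{v} C]

section Preadditive

variable [Preadditive C] {D : CocyclicData C}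

lemma totalD_add_two {A : C} {n : ℕ} {x : ∀ q, A ⟶ D.X q} (hx : ∀ q, n < q → x q = 0) :
    D.totalD (n + 2) x = D.totalD n x := by
  have horiz_add_two (p q : ℕ) : D.horiz (p + 2) q = D.horiz p q := by
    simp [horiz, Nat.even_add]
  have vert_add_two (p q : ℕ) : D.vert (p + 2) q = D.vert p q := by
    simp [vert, Nat.even_add]
  funext q
  cases q with
  | zero => simp only [totalD, horiz_add_two]
  | succ q =>
    refine congrArg₂ (· + ·) ?_ ?_
    · by_cases hq : q + 1 ≤ n
      · rw [Nat.sub_add_comm hq, horiz_add_two]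
      · rw [hx _ (by omega), zero_comp, zero_comp]
    · by_cases hq : q ≤ n
      · rw [Nat.sub_add_comm hq, vert_add_two, pow_add]
        simp
      · rw [hx _ (by omega), zero_comp, zero_comp, smul_zero, smul_zero]

variable (D) in
/-- The contraction of the complex `(X, -b')` given by the last codegeneracies. -/
def contraction (n : ℕ) : D.X (n + 1) ⟶ D.X n := -((-1 : ℤ) ^ n • D.σ n n)

lemma IsCocyclic.b'_zero_contraction (h : D.IsCocyclic) : D.b' 0 ≫ D.contraction 0 = -𝟙 _ := by
  simp [b', altSum, contraction, h.δ_σ_self 0 0 le_rfl]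

lemma IsCocyclic.b'_succ_contraction (h : D.IsCocyclic) (n : ℕ) :
    D.b' (n + 1) ≫ D.contraction (n + 1) + D.contraction n ≫ D.b' n = -𝟙 _ := by
  have b'_σ : D.b' (n + 1) ≫ D.σ (n + 1) (n + 1) = D.σ n n ≫ D.b' n + (-1 : ℤ) ^ (n + 1) • 𝟙 _ := by
    rw [b', altSum, Finset.sum_range_succ, Preadditive.add_comp, Preadditive.zsmul_comp,
      h.δ_σ_self (n + 1) (n + 1) le_rfl, b', altSum, Preadditive.sum_comp, Preadditive.comp_sum]
    congr 1
    refine Finset.sum_congr rfl fun i hi => ?_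
    rw [Preadditive.zsmul_comp, Preadditive.comp_zsmul,
      h.δ_σ_lt n i n (Finset.mem_range_succ_iff.1 hi) le_rfl]
  rcases neg_one_pow_eq_or ℤ n with hn | hn <;> simp [contraction, b'_σ, pow_succ, hn]

end Preadditive

namespace IsCocyclic

variable [Abelian C] {D : CocyclicData C} (h : D.IsCocyclic)

/-- The identification of the columns `p ≥ 2` of the cyclic bicomplex with the whole bicomplex. -/
def periodicity : shiftTwo h.tot ⟶ h.tot :=
  ofShiftTwo (fun n => h.lift (n + 2) (h.proj n)) fun n => by
    rw [h.lift_d fun _ hq => h.proj_eq_zero (by omega), totalD_add_two fun _ => h.proj_eq_zero]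
    refine hom_ext_proj fun q hq => ?_
    rw [Category.assoc, h.lift_proj hq, h.lift_proj hq, d_proj]

lemma periodicity_f (n : ℕ) : h.periodicity.f (n + 2) =
    (shiftTwoXIso h.tot n).hom ≫ h.lift (n + 2) (h.proj n) := rfl

instance (n : ℕ) : Mono (h.periodicity.f n) :=
  match n with
  | 0 => (isZero_shiftTwo_X _ Nat.zero_lt_two).mono _
  | 1 => (isZero_shiftTwo_X _ Nat.one_lt_two).mono _
  | n + 2 => by
    have retraction : h.lift (n + 2) (h.proj n) ≫ h.lift n (h.proj (n + 2)) = 𝟙 _ :=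
      hom_ext_proj fun q hq => by
        rw [Category.assoc, h.lift_proj hq, h.lift_proj (by omega), Category.id_comp]
    have : Mono (h.lift (n + 2) (h.proj n)) := mono_of_mono_fac retraction
    rw [periodicity_f]
    infer_instance

instance : Mono h.periodicity := HomologicalComplex.mono_of_mono_f _ inferInstance

lemma periodicity_proj {n q : ℕ} (hq : n < q + 2) : h.periodicity.f n ≫ h.proj n q = 0 :=
  match n with
  | 0 => (isZero_shiftTwo_X _ Nat.zero_lt_two).eq_of_src _ _
  | 1 => (isZero_shiftTwo_X _ Nat.one_lt_two).eq_of_src _ _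
  | n + 2 => by
    rw [periodicity_f, Category.assoc, h.lift_proj_of_eq_zero fun _ hq => h.proj_eq_zero (by omega),
      h.proj_eq_zero (by omega), comp_zero]

lemma exists_comp_periodicity_eq {A : CochainComplex C ℕ} (φ : A ⟶ h.tot)
    (hφ : ∀ n q, n < q + 2 → φ.f n ≫ h.proj n q = 0) : ∃ ψ, ψ ≫ h.periodicity = φ := by
  refine exists_comp_eq_of_degreewise _ _ fun n => ?_
  by_cases hn : n < 2
  · refine ⟨0, hom_ext_proj fun q _ => ?_⟩
    rw [zero_comp, zero_comp, hφ n q (by omega)]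
  · obtain ⟨n, rfl⟩ := Nat.exists_eq_add_of_le' (not_lt.1 hn)
    refine ⟨φ.f (n + 2) ≫ h.lift n (h.proj (n + 2)) ≫ (shiftTwoXIso h.tot n).inv,
      hom_ext_proj fun q hq => ?_⟩
    rw [periodicity_f, Category.assoc, Category.assoc, Category.assoc, Category.assoc,
      Iso.inv_hom_id_assoc, h.lift_proj hq]
    by_cases hqn : q ≤ n
    · rw [h.lift_proj hqn]
    · rw [h.proj_eq_zero (by omega), comp_zero, comp_zero, hφ _ q (by omega)]

lemma periodicity_toColumnZero : h.periodicity ≫ h.toColumnZero = 0 := by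
  ext n
  exact h.periodicity_proj (by omega)

/-- The operators of degree `-1` on the total complex which contract column one and vanish on the
other columns. -/
def columnOneContraction (i : ℕ) : ∀ j, h.tot.X i ⟶ h.tot.X j
  | 0 => 0
  | j + 1 => h.proj i (j + 1) ≫ D.contraction j ≫ h.inc (j + 1) j

/-- The null-homotopic endomorphism of the total complex obtained by contracting column one. -/
def columnOneMap : h.tot ⟶ h.tot :=
  Homotopy.nullHomotopicMap' fun i j _ => h.columnOneContraction i j

/-- The null homotopy of `columnOneMap`. -/
def columnOneHomotopy : Homotopy h.columnOneMap 0 := Homotopy.nullHomotopy' _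

lemma columnOneMap_toColumnZero : h.columnOneMap ≫ h.toColumnZero = 0 := by
  rw [columnOneMap, Homotopy.nullHomotopicMap'_comp, ← nullHomotopicMap'_zero]
  congr
  funext i j _
  cases j with
  | zero => exact zero_comp
  | succ j =>
    change (_ ≫ _ ≫ h.inc (j + 1) j) ≫ h.proj (j + 1) (j + 1) = 0
    rw [Category.assoc, Category.assoc, h.inc_proj j.le_succ, D.kronecker_of_ne j.lt_succ_self.ne,
      comp_zero, comp_zero]

lemma periodicity_columnOneMap : h.periodicity ≫ h.columnOneMap = 0 := by
  rw [columnOneMap, Homotopy.comp_nullHomotopicMap', ← nullHomotopicMap'_zero]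
  congr
  funext i j hij
  obtain rfl : j + 1 = i := hij
  cases j with
  | zero => exact comp_zero
  | succ j =>
    change _ ≫ _ ≫ _ = 0
    rw [← Category.assoc, h.periodicity_proj (by omega), zero_comp]

lemma d_proj_columnOne (n : ℕ) : h.tot.d (n + 1) (n + 2) ≫ h.proj (n + 2) (n + 1) =
    h.proj (n + 1) (n + 1) ≫ D.horiz 0 (n + 1) - h.proj (n + 1) n ≫ D.b' n := by
  rw [d_proj]
  simp [totalD, vert, sub_eq_add_neg]

lemma inc_d_proj_columnOne (n : ℕ) :
    h.inc (n + 1) n ≫ h.tot.d (n + 1) (n + 2) ≫ h.proj (n + 2) (n + 1) = -D.b' n := by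
  rw [d_proj_columnOne, Preadditive.comp_sub, ← Category.assoc, ← Category.assoc,
    h.inc_proj n.le_succ, h.inc_proj n.le_succ, D.kronecker_of_ne n.lt_succ_self.ne, zero_comp,
    kronecker_self, Category.id_comp, zero_sub]

lemma columnOneMap_proj (n : ℕ) : h.columnOneMap.f (n + 1) ≫ h.proj (n + 1) n =
    h.proj (n + 1) n + h.proj (n + 1) (n + 1) ≫ D.horiz 0 (n + 1) ≫ D.contraction n := by
  rw [columnOneMap, Homotopy.nullHomotopicMap'_f (k₂ := n) (k₀ := n + 2) rfl rfl,
    Preadditive.add_comp, columnOneContraction]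
  simp only [Category.assoc]
  rw [h.inc_proj n.le_succ, kronecker_self, Category.comp_id, ← Category.assoc, d_proj_columnOne,
    Preadditive.sub_comp]
  simp only [Category.assoc]
  cases n with
  | zero =>
    rw [h.b'_zero_contraction, columnOneContraction, zero_comp]
    simp [add_comm]
  | succ n =>
    rw [eq_sub_of_add_eq (h.b'_succ_contraction n), columnOneContraction]
    simp only [Category.assoc, h.inc_d_proj_columnOne]
    simp only [Preadditive.comp_neg, Preadditive.comp_sub, Category.comp_id]
    abel

theorem nonempty_tot_homology_iso {ρ : ∀ n q, D.X n ⟶ D.X q} (hρ : D.IsColumnZeroSection ρ)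
    (n : ℕ) : Nonempty (h.tot.homology n ≅
      h.hochschild.homology n ⊞ (shiftTwo h.tot).homology n) := by
  have sub_toColumnZero :
      (𝟙 h.tot - h.toColumnZero ≫ ofColumnZero hρ) ≫ h.toColumnZero = 0 := by
    rw [Preadditive.sub_comp, Category.assoc, ofColumnZero_toColumnZero, Category.id_comp,
      Category.comp_id, sub_self]
  have sub_proj (m : ℕ) :
      (𝟙 h.tot - h.toColumnZero ≫ ofColumnZero hρ).f m ≫ h.proj m m = 0 :=
    HomologicalComplex.congr_hom sub_toColumnZero m
  have columnOneMap_proj_self (m : ℕ) : h.columnOneMap.f m ≫ h.proj m m = 0 :=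
    HomologicalComplex.congr_hom h.columnOneMap_toColumnZero m
  have sub_columnOneMap_proj (m q : ℕ) : (𝟙 h.tot - h.columnOneMap).f m ≫ h.proj m q =
      h.proj m q - h.columnOneMap.f m ≫ h.proj m q := by
    rw [HomologicalComplex.sub_f_apply, HomologicalComplex.id_f, Preadditive.sub_comp,
      Category.id_comp]
  obtain ⟨ψ, hψ⟩ := h.exists_comp_periodicity_eq
    ((𝟙 h.tot - h.toColumnZero ≫ ofColumnZero hρ) ≫ (𝟙 h.tot - h.columnOneMap)) fun m q hq => by
      rw [HomologicalComplex.comp_f, Category.assoc, sub_columnOneMap_proj]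
      obtain hq | rfl | rfl : m < q ∨ m = q ∨ m = q + 1 := by omega
      · rw [h.proj_eq_zero hq, comp_zero, sub_zero, comp_zero]
      · rw [columnOneMap_proj_self, sub_zero, sub_proj]
      · rw [columnOneMap_proj, sub_add_cancel_left, Preadditive.comp_neg, ← Category.assoc,
          sub_proj, zero_comp, neg_zero]
  exact nonempty_homology_iso_biprod (ofColumnZero_toColumnZero hρ) h.periodicity_toColumnZero
    h.columnOneHomotopy h.periodicity_columnOneMap hψ n

end IsCocyclic

end CocyclicData

end Periodicity

/-! ### The direct sum decomposition -/

section Biproducts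

variable {C : Type u} [Category.{v} C] [HasZeroMorphisms C]
  [HasBinaryBiproducts C] [HasFiniteBiproducts C]

/-- A biproduct over `Option J` is the binary biproduct of the summand at `none` and the biproduct
over `J`. -/
def biproductOptionIso {J : Type*} [Finite J] (f : Option J → C) :
    ⨁ f ≅ f none ⊞ ⨁ fun j => f (some j) where
  hom := biproduct.desc fun
    | none => biprod.inl
    | some j => biproduct.ι (fun j => f (some j)) j ≫ biprod.inr
  inv := biprod.desc (biproduct.ι f none) (biproduct.desc fun j => biproduct.ι f (some j))
  hom_inv_id := by
    refine biproduct.hom_ext' _ _ fun j => ?_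
    cases j <;> simp
  inv_hom_id := by
    refine biprod.hom_ext' _ _ ?_ ?_
    · simp
    · refine biproduct.hom_ext' _ _ fun j => ?_
      simp

/-- The natural numbers `i ≤ n` with the parity of `n`. -/
abbrev ParityIndex (n : ℕ) : Type := {i : Fin (n + 1) // (i : ℕ) ≡ n [MOD 2]}

/-- The map from `Option (ParityIndex n)` to `ParityIndex (n + 2)` sending `none` to `n + 2`. -/
def parityIndexMap (n : ℕ) : Option (ParityIndex n) → ParityIndex (n + 2)
  | none => ⟨⟨n + 2, by omega⟩, rfl⟩
  | some i => ⟨⟨i, by omega⟩, i.2.trans (by simp [Nat.ModEq])⟩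

lemma parityIndexMap_bijective (n : ℕ) : Function.Bijective (parityIndexMap n) := by
  constructor
  · rintro (_ | ⟨⟨i, hi⟩, hi'⟩) (_ | ⟨⟨j, hj⟩, hj'⟩) hij
    · rfl
    · have : n + 2 = j := congrArg (fun k => (k.1 : ℕ)) hij
      omega
    · have : i = n + 2 := congrArg (fun k => (k.1 : ℕ)) hij
      omega
    · obtain rfl : i = j := congrArg (fun k => (k.1 : ℕ)) hij
      rfl
  · rintro ⟨⟨i, hi⟩, hi'⟩
    by_cases h : i = n + 2
    · exact ⟨none, by subst h; rfl⟩
    · have i_mod : i % 2 = (n + 2) % 2 := hi'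
      exact ⟨some ⟨⟨i, by omega⟩, show i % 2 = n % 2 by omega⟩, rfl⟩

lemma nonempty_iso_biproduct_of_recursion (T A : ℕ → C) (h_zero : Nonempty (T 0 ≅ A 0))
    (h_one : Nonempty (T 1 ≅ A 1))
    (h_add_two : ∀ n, Nonempty (T (n + 2) ≅ A (n + 2) ⊞ T n)) :
    ∀ n : ℕ, Nonempty (T n ≅ ⨁ fun i : ParityIndex n => A i)
  | 0 => by
    let _ : Unique (ParityIndex 0) := ⟨⟨⟨0, rfl⟩⟩, fun i => Subtype.ext (Fin.ext (by omega))⟩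
    exact ⟨h_zero.some ≪≫ (biproductUniqueIso fun i : ParityIndex 0 => A i).symm⟩
  | 1 => by
    let _ : Unique (ParityIndex 1) := ⟨⟨⟨1, rfl⟩⟩, fun i => Subtype.ext (Fin.ext (by
      have hi : (i.1 : ℕ) % 2 = 1 % 2 := i.2
      have := i.1.2
      change (i.1 : ℕ) = 1
      omega))⟩
    exact ⟨h_one.some ≪≫ (biproductUniqueIso fun i : ParityIndex 1 => A i).symm⟩
  | n + 2 => by
    obtain ⟨e⟩ := nonempty_iso_biproduct_of_recursion T A h_zero h_one h_add_two n
    have e' : (⨁ fun i : Option (ParityIndex n) => A (parityIndexMap n i)) ≅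
        ⨁ fun i : ParityIndex (n + 2) => A i :=
      biproduct.whiskerEquiv (Equiv.ofBijective _ (parityIndexMap_bijective n))
        (f := fun i : Option (ParityIndex n) => A (parityIndexMap n i))
        (g := fun i : ParityIndex (n + 2) => A i) fun _ => Iso.refl _
    exact ⟨(h_add_two n).some ≪≫ biprod.mapIso (Iso.refl _) e ≪≫
      (biproductOptionIso fun i : Option (ParityIndex n) => A (parityIndexMap n i)).symm ≪≫ e'⟩

end Biproducts

namespace CocyclicData.IsCocyclic

variable {C : Type u} [Category.{v} C] [Abelian C] {D : CocyclicData C} (h : D.IsCocyclic)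

theorem nonempty_tot_homology_iso_biproduct {ρ : ∀ n q, D.X n ⟶ D.X q}
    (hρ : D.IsColumnZeroSection ρ) (n : ℕ) :
    Nonempty (h.tot.homology n ≅ ⨁ fun i : ParityIndex n => h.hochschild.homology i) := by
  have iso_of_lt_two (m : ℕ) (hm : m < 2) :
      Nonempty (h.tot.homology m ≅ h.hochschild.homology m) :=
    ⟨(h.nonempty_tot_homology_iso hρ m).some ≪≫
      (isoBiprodZero (isZero_shiftTwo_homology h.tot hm)).symm⟩
  refine nonempty_iso_biproduct_of_recursion (fun m => h.tot.homology m)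
    (fun m => h.hochschild.homology m) (iso_of_lt_two 0 Nat.zero_lt_two)
    (iso_of_lt_two 1 Nat.one_lt_two) (fun m => ?_) n
  exact ⟨(h.nonempty_tot_homology_iso hρ (m + 2)).some ≪≫
    biprod.mapIso (Iso.refl _) (shiftTwoHomologyIso h.tot m)⟩

end CocyclicData.IsCocyclic

lemma exists_isColumnZeroSection_hopfCocyclicData {C : Type u} [Category.{v} C] [Preadditive C]
    [MonoidalCategory C] [SymmetricCategory C] (H : C) [HopfObj H] [IsCommMonObj H] :
    ∃ ρ, (hopfCocyclicData H ε[H] η[H]).IsColumnZeroSection ρ :=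
  cocyclic_map_vertexFunctor H ▸ VertexCat.exists_isColumnZeroSection (vertexFunctor H)

end HopfCyclic

end

theorem mainTheorem6 {C : Type u} [Category.{v} C] [Abelian C] [MonoidalCategory C]
    [SymmetricCategory C] (H : C) [HopfObj H] [IsCommMonObj H] :
    HopfCyclic.IsModularPairInInvolution H ε[H] η[H] ∧
      ∃ h : (HopfCyclic.hopfCocyclicData H ε[H] η[H]).IsCocyclic, ∀ n : ℕ,
        Nonempty (h.cyclicCohomology n ≅
          ⨁ fun i : {i : Fin (n + 1) // (i : ℕ) ≡ n [MOD 2]} =>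
            HopfCyclic.hochschildCohomology H i) := by
  obtain ⟨_, hρ⟩ := HopfCyclic.exists_isColumnZeroSection_hopfCocyclicData H
  exact ⟨HopfCyclic.isModularPairInInvolution H, HopfCyclic.isCocyclic_hopfCocyclicData H,
    fun n => (HopfCyclic.isCocyclic_hopfCocyclicData H).nonempty_tot_homology_iso_biproduct hρ n⟩
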